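/- Fix real numbers $\lambda,\mu,\nu>0$, an integer $K\ge 1$ and a real number $0<M\le K$. For $n\ge1$ let $(Q^n(t),Z^n(t))_{t\ge0}$ be the continuous-time Markov chain on $\{(q,z)\in\mathbb Z^2:0\le z\le q\le nK\}$ (a charging station with $nK$ parking spaces; $q$ vehicles are present, $z$ of them uncharged) with transition rates $$(q,z)\to(q+1,z+1)\text{ at rate }n\lambda\ \ (q<nK),\qquad (q,z)\to(q,z-1)\text{ at rate }\mu\min(z,nM),$$ $$(q,z)\to(q-1,z-1)\text{ at rate }\nu z,\qquad (q,z)\to(q-1,z)\text{ at rate }\nu(q-z).$$ A fluid-model solution is a continuous function $z:[0,\infty)\to[0,K]$ with $z'(t)=\min(\lambda,\nu K)-\nu z(t)-\mu\min(z(t),M)$ for all $t\ge0$ (one-sided derivative at $t=0$). Then there is a number $z^*>0$ that is both the unique invariant point of the fluid model (the unique constant solution) and the unique positive solution of $$z^*=\min(\lambda,\nu K)\,\mathbb E\big[\min\{D,\,B\max(1,z^*/M)\}\big],$$ where $D$ and $B$ are independent exponential random variables with rates $\nu$ and $\mu$, and such that the following hold. 1. For every $n$ the chain has a unique stationary law,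 the law of a random vector $(Q^n(\infty),Z^n(\infty))$, and for every initial law the law of $(Q^n(t),Z^n(t))$ converges to it as $t\to\infty$. 2. The sequence $Z^n(\infty)/n$, $n\ge1$, is tight, and $Z^n(\infty)/n\overset{d}{\to}z^*$ as $n\to\infty$. 3. Hence the limits $n\to\infty$ and $t\to\infty$ can be interchanged. For every $z_0\in[0,K]$ there is a unique fluid-model solution $z$ with $z(0)=z_0$. If $Z^n(0)/n\overset{d}{\to}z_0$ and $Q^n(0)/n\overset{d}{\to}K$ as $n\to\infty$, then for every $t\ge 0$ one has $Z^n(t)/n\overset{d}{\to}z(t)$ as $n\to\infty$, and $z(t)\to z^*$ as $t\to\infty$. On the other hand, for every $n$ one has $Z^n(t)/n\overset{d}{\to}Z^n(\infty)/n$ as $t\to\infty$, and $Z^n(\infty)/n\overset{d}{\to}z^*$ as $n\to\infty$. So both iterated limits equal $z^*$. -/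

import Mathlib

open MeasureTheory ProbabilityTheory Filter Topology
open scoped NNReal

namespace EVCharging

/-! ### Continuous-time Markov chains on a finite state space -/

section MarkovChain

variable {S : Type*} [Fintype S] [DecidableEq S]

/-- The generator with off-diagonal jump rates `r`: rows sum to zero. -/
def generatorOfRates (r : S → S → ℝ) : Matrix S S ℝ :=
  fun x y => if x = y then -∑ u ∈ Finset.univ.erase x, r x u else r x y

/-- The transition probabilities `P_t(x, y)` over a time span `t`, i.e. the matrix `exp(t G)`. -/
noncomputable def transitionMatrix (G : Matrix S S ℝ) (t : ℝ) : Matrix S S ℝ :=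
  NormedSpace.exp (t • G)

/-- `X` is a time-homogeneous Markov process with generator `G` under `P` (with arbitrary initial
law): its finite-dimensional distributions are those prescribed by the transition
probabilities `exp(t G)`. -/
structure IsMarkovProcess [MeasurableSpace S] {Ω : Type*} [MeasurableSpace Ω]
    (G : Matrix S S ℝ) (P : Measure Ω) (X : ℝ≥0 → Ω → S) : Prop where
  measurable : ∀ t, Measurable (X t)
  finite_dim : ∀ (k : ℕ) (t : Fin (k + 1) → ℝ≥0), Monotone t → ∀ x : Fin (k + 1) → S,
    P.real {ω | ∀ i, X (t i) ω = x i} =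
      P.real {ω | X (t 0) ω = x 0} *
        ∏ i : Fin k, transitionMatrix G ((t i.succ : ℝ) - (t i.castSucc : ℝ))
          (x i.castSucc) (x i.succ)

/-- `π` is a stationary law of the Markov process with generator `G`: a probability measure
with `π P_t = π` for all `t ≥ 0`. -/
def IsStationaryLaw [MeasurableSpace S] (G : Matrix S S ℝ) (π : Measure S) : Prop :=
  IsProbabilityMeasure π ∧
    ∀ t : ℝ≥0, ∀ y : S, ∑ x, π.real {x} * transitionMatrix G t x y = π.real {y}

end MarkovChain

/-! ### The charging station -/

/-- States `(q, z)`, `0 ≤ z ≤ q ≤ N`, of a station with `N` parking spaces: `q` vehicles are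
present, `z` of them not fully charged. -/
abbrev State (N : ℕ) : Type := {s : Fin (N + 1) × Fin (N + 1) // s.2 ≤ s.1}

/-- The total number `q` of vehicles. -/
def total {N : ℕ} (s : State N) : ℕ := s.1.1

/-- The number `z` of uncharged vehicles. -/
def uncharged {N : ℕ} (s : State N) : ℕ := s.1.2

/-- The power allocation function `L(x) = min x M`. -/
noncomputable def allocation (M x : ℝ) : ℝ := min x M

/-- The jump rates of `(Q, Z)` in a station with arrival rate `lam`, charging rate `mu`, parking
rate `nu`, power capacity `M` and `N` parking spaces. Arrivals at a full station are lost: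
there is no state with `q = N + 1`. -/
noncomputable def jumpRate (lam mu nu M : ℝ) {N : ℕ} (s s' : State N) : ℝ :=
  -- an arrival
  if total s' = total s + 1 ∧ uncharged s' = uncharged s + 1 then lam
  -- a vehicle becomes fully charged
  else if total s' = total s ∧ uncharged s = uncharged s' + 1 then
    mu * allocation M (uncharged s)
  -- an uncharged vehicle departs
  else if total s = total s' + 1 ∧ uncharged s = uncharged s' + 1 then nu * uncharged s
  -- a fully charged vehicle departs
  else if total s = total s' + 1 ∧ uncharged s' = uncharged s then
    nu * ((total s : ℝ) - uncharged s)
  else 0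

/-- The generator of the `n`-th system under fluid scaling: arrival rate `n lam`, power capacity
`n M`, `n K` parking spaces; `mu` and `nu` are not scaled. -/
noncomputable def scaledGenerator (lam mu nu M : ℝ) (K : ℕ) (n : ℕ+) :
    Matrix (State (n * K)) (State (n * K)) ℝ :=
  generatorOfRates (jumpRate (n * lam) mu nu (n * M))

/-- The fluid-scaled number `Z / n` of uncharged vehicles. -/
noncomputable def scaledUncharged {K : ℕ} (n : ℕ+) (s : State (n * K)) : ℝ :=
  (uncharged s : ℝ) / n

/-- The fluid-scaled total number `Q / n` of vehicles. -/
noncomputable def scaledTotal {K : ℕ} (n : ℕ+) (s : State (n * K)) : ℝ :=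
  (total s : ℝ) / n

/-! ### The fluid model -/

/-- The right-hand side `R(x) = min(lam, nu K) - nu x - mu min(x, M)` of the fluid equation. -/
noncomputable def fluidDrift (lam mu nu M : ℝ) (K : ℕ) (x : ℝ) : ℝ :=
  min lam (nu * K) - nu * x - mu * allocation M x

/-- Fluid-model solutions: continuous `z : [0, ∞) → [0, K]` with `z' = R(z)`. -/
structure IsFluidSolution (lam mu nu M : ℝ) (K : ℕ) (z : ℝ → ℝ) : Prop where
  continuousOn : ContinuousOn z (Set.Ici 0)
  mem_Icc : ∀ t, 0 ≤ t → z t ∈ Set.Icc (0 : ℝ) K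
  hasDeriv : ∀ t, 0 ≤ t →
    HasDerivWithinAt z (fluidDrift lam mu nu M K (z t)) (Set.Ici 0) t

/-- `x` is an invariant point of the fluid model: `z(t) = x` for all `t` is a solution. -/
def IsInvariantPoint (lam mu nu M : ℝ) (K : ℕ) (x : ℝ) : Prop :=
  IsFluidSolution lam mu nu M K (fun _ => x)

/-- `x` solves `x = min(lam, nu K) E[min(D, B max(1, x / M))]` with independent exponential
`D`, `B` of rates `nu`, `mu`. -/
def SolvesFixedPoint (lam mu nu M : ℝ) (K : ℕ) (x : ℝ) : Prop :=
  x = min lam (nu * K) *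
    ∫ p : ℝ × ℝ, min p.1 (p.2 * max 1 (x / M)) ∂((expMeasure nu).prod (expMeasure mu))

end EVCharging

open EVCharging

open EVCharging

namespace EVCharging

/-! ### Finite-state chains: positivity, Doeblin contraction, Gronwall for expectations. -/

section MarkovChain

variable {S : Type*} [Fintype S] [DecidableEq S]

/-! For each n the station is a finite chain whose empty state is reachable from everywhere, so
Doeblin's contraction yields a unique stationary law and convergence to it.

The limits in n come from one estimate, `exists_msd_bound`. Along any fluid solution z, the mean
square of Z^n(t)/n - z(t) is at most C(δ + √δ), where δ is e^{-νt} times a measure of the initial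
error, plus 1/n, and C depends neither on n nor on t. With t fixed and n → ∞ this is the fluid
limit. For the stationary law and the constant solution z*, the left side does not depend on t, so
letting t → ∞ erases the initial error and leaves C(1/n + √(1/n)). The interchange rests on this
uniformity in t.

The estimate is a Gronwall bound for Lyapunov functions of degree two (`sum_lawAt_mul_le`,
`lyapunov_scaled`). Scaled jumps have size h = 1/n, so the generator acts as a first-order drift
plus O(h), and the monotonicity of min(·, M) helps. The obstacle is the blocking of arrivals at a
full station. If νK ≤ λ, one follows the charged vehicles Q - Z, which arrivals leave unchanged,
together with (K - Q/n)² (`drift_charged_saturated`). If λ ≤ νK, one compares Q/n with the solution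
q of q' = λ - νq, and adds 2K(Q/n - q) to (Z/n - z)²; this gives the blocking term a sign
(`drift_uncharged_unsaturated`). The linear term is then controlled by the mean square of Q/n - q,
whence the √δ.

The fluid drift is strictly decreasing and dissipative. This gives one zero z*, uniqueness of
solutions and exponential attraction to z*. As min(D, Bc) is exponential of rate ν + μ/c, the
fixed-point equation says that the drift vanishes. -/

theorem sum_generatorOfRates (r : S → S → ℝ) (x : S) : ∑ y, generatorOfRates r x y = 0 := by
  rw [← Finset.add_sum_erase _ _ (Finset.mem_univ x)]
  have : ∑ y ∈ Finset.univ.erase x, generatorOfRates r x y = ∑ y ∈ Finset.univ.erase x, r x y := by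
    refine Finset.sum_congr rfl fun y hy => ?_
    simp [generatorOfRates, (Finset.ne_of_mem_erase hy).symm]
  rw [this]
  simp [generatorOfRates]

theorem generatorOfRates_mulVec (r : S → S → ℝ) (f : S → ℝ) (x : S) :
    ∑ y, generatorOfRates r x y * f y = ∑ y, r x y * (f y - f x) := by
  have h := sum_generatorOfRates r x
  have h1 : ∑ y, generatorOfRates r x y * f y = ∑ y, generatorOfRates r x y * (f y - f x) := by
    simp_rw [mul_sub, Finset.sum_sub_distrib, ← Finset.sum_mul, h]
    simp
  rw [h1]
  refine Finset.sum_congr rfl fun y _ => ?_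
  by_cases hxy : x = y
  · simp [hxy]
  · simp [generatorOfRates, hxy]

theorem transitionMatrix_zero (G : Matrix S S ℝ) : transitionMatrix G 0 = 1 := by
  simp [transitionMatrix]

theorem transitionMatrix_add (G : Matrix S S ℝ) (s t : ℝ) :
    transitionMatrix G (s + t) = transitionMatrix G s * transitionMatrix G t := by
  unfold transitionMatrix
  rw [add_smul]
  exact Matrix.exp_add_of_commute _ _ (((Commute.refl G).smul_left s).smul_right t)

open scoped Matrix.Norms.Operator in
theorem hasDerivAt_transitionMatrix (G : Matrix S S ℝ) (t : ℝ) (x y : S) :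
    HasDerivAt (fun t => transitionMatrix G t x y) (∑ z, transitionMatrix G t x z * G z y) t := by
  have h := hasDerivAt_exp_smul_const (𝕂 := ℝ) G t
  exact (hasDerivAt_pi.1 ((hasDerivAt_pi.1 h) x)) y

open scoped Matrix.Norms.Operator in
theorem hasDerivAt_transitionMatrix' (G : Matrix S S ℝ) (t : ℝ) (x y : S) :
    HasDerivAt (fun t => transitionMatrix G t x y) (∑ z, G x z * transitionMatrix G t z y) t := by
  have h := hasDerivAt_exp_smul_const' (𝕂 := ℝ) G t
  exact (hasDerivAt_pi.1 ((hasDerivAt_pi.1 h) x)) y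

open scoped Matrix.Norms.Operator in
theorem hasSum_exp_apply (A : Matrix S S ℝ) (x y : S) :
    HasSum (fun n : ℕ => ((n.factorial : ℝ)⁻¹) * (A ^ n) x y) (NormedSpace.exp A x y) := by
  have h := NormedSpace.exp_series_hasSum_exp' (𝕂 := ℝ) A
  exact (Pi.hasSum.1 ((Pi.hasSum.1 h) x)) y

theorem sum_transitionMatrix {G : Matrix S S ℝ} (hG : ∀ x, ∑ y, G x y = 0) (t : ℝ) (x : S) :
    ∑ y, transitionMatrix G t x y = 1 := by
  have hd : ∀ t, HasDerivAt (fun t => ∑ y, transitionMatrix G t x y) 0 t := by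
    intro t
    have h := HasDerivAt.fun_sum (u := Finset.univ) fun y _ => hasDerivAt_transitionMatrix G t x y
    refine h.congr_deriv ?_
    rw [Finset.sum_comm]
    simp_rw [← Finset.mul_sum, hG]
    simp
  have h := is_const_of_deriv_eq_zero (fun t => (hd t).differentiableAt) (fun t => (hd t).deriv) t 0
  rw [h]
  simp [transitionMatrix_zero, Matrix.one_apply]

theorem sum_mul_transitionMatrix_of_null {G : Matrix S S ℝ} {v : S → ℝ}
    (hv : ∀ y, ∑ x, v x * G x y = 0) (t : ℝ) (y : S) :
    ∑ x, v x * transitionMatrix G t x y = v y := by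
  have hd : ∀ t, HasDerivAt (fun t => ∑ x, v x * transitionMatrix G t x y) 0 t := by
    intro t
    have h := HasDerivAt.fun_sum (u := Finset.univ) fun x _ =>
      (hasDerivAt_transitionMatrix' G t x y).const_mul (v x)
    refine h.congr_deriv ?_
    simp_rw [Finset.mul_sum]
    rw [Finset.sum_comm]
    simp_rw [← mul_assoc, ← Finset.sum_mul, hv]
    simp
  have h := is_const_of_deriv_eq_zero (fun t => (hd t).differentiableAt) (fun t => (hd t).deriv) t 0
  rw [h]
  simp [transitionMatrix_zero, Matrix.one_apply]

theorem pow_apply_nonneg {A : Matrix S S ℝ} (hA : ∀ x y, 0 ≤ A x y) (n : ℕ) (x y : S) :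
    0 ≤ (A ^ n) x y := by
  induction n generalizing x y with
  | zero =>
    simp only [pow_zero, Matrix.one_apply]
    split_ifs <;> norm_num
  | succ n ih =>
    rw [pow_succ, Matrix.mul_apply]
    exact Finset.sum_nonneg fun z _ => mul_nonneg (ih x z) (hA z y)

theorem transitionMatrix_add_smul_one (A : Matrix S S ℝ) (c t : ℝ) :
    transitionMatrix (A + c • 1) t = Real.exp (t * c) • NormedSpace.exp (t • A) := by
  unfold transitionMatrix
  have hc : t • (A + c • (1 : Matrix S S ℝ)) = t • A + (t * c) • (1 : Matrix S S ℝ) := by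
    rw [smul_add, smul_smul]
  rw [hc, Matrix.exp_add_of_commute _ _ ((Commute.one_right _).smul_right _)]
  have h1 : NormedSpace.exp ((t * c) • (1 : Matrix S S ℝ)) =
      Real.exp (t * c) • (1 : Matrix S S ℝ) := by
    have : ((t * c) • (1 : Matrix S S ℝ)) = Matrix.diagonal (fun _ => t * c) := by
      rw [Matrix.smul_one_eq_diagonal]
    rw [this, Matrix.exp_diagonal, Matrix.smul_one_eq_diagonal, Real.exp_eq_exp_ℝ]
    congr 1
    ext i
    rw [Pi.coe_exp]
  rw [h1]
  simp

/-- Uniformization: a generator is a nonnegative matrix up to a multiple of the identity. -/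
theorem exists_nonneg_add_smul_one {r : S → S → ℝ} (hr : ∀ x y, x ≠ y → 0 ≤ r x y) :
    ∃ (A : Matrix S S ℝ) (c : ℝ), (∀ x y, 0 ≤ A x y) ∧ (∀ x y, x ≠ y → A x y = r x y) ∧
      generatorOfRates r = A + c • 1 := by
  obtain ⟨c, hc⟩ : ∃ c : ℝ, ∀ x, -generatorOfRates r x x ≤ c :=
    ⟨∑ x, |generatorOfRates r x x|, fun x => (neg_le_abs _).trans
      (Finset.single_le_sum (f := fun x => |generatorOfRates r x x|)
        (fun _ _ => abs_nonneg _) (Finset.mem_univ x))⟩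
  refine ⟨generatorOfRates r + c • 1, -c, ?_, ?_, by simp⟩
  · intro x y
    by_cases h : x = y
    · subst h
      have := hc x
      simp
      linarith
    · simpa [h, generatorOfRates] using hr x y h
  · intro x y h
    simp [h, generatorOfRates]

/-- After uniformization every term of the exponential series is nonnegative. The terms of order 0
and 1 give the two lower bounds, with e the scalar factor from the multiple of the identity. -/
theorem transitionMatrix_ge {r : S → S → ℝ} (hr : ∀ x y, x ≠ y → 0 ≤ r x y) {t : ℝ}
    (ht : 0 ≤ t) : ∃ e : ℝ, 0 < e ∧ (∀ x y, 0 ≤ transitionMatrix (generatorOfRates r) t x y) ∧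
      (∀ x, e ≤ transitionMatrix (generatorOfRates r) t x x) ∧
      ∀ x y, x ≠ y → e * (t * r x y) ≤ transitionMatrix (generatorOfRates r) t x y := by
  obtain ⟨A, c, hA, hAr, hG⟩ := exists_nonneg_add_smul_one hr
  have hA' : ∀ x y, 0 ≤ (t • A) x y := fun x y => mul_nonneg ht (hA x y)
  have hterm : ∀ x y (n : ℕ), 0 ≤ ((n.factorial : ℝ)⁻¹) * ((t • A) ^ n) x y := fun x y n =>
    mul_nonneg (by positivity) (pow_apply_nonneg hA' n x y)
  rw [hG, transitionMatrix_add_smul_one]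
  refine ⟨Real.exp (t * c), Real.exp_pos _, fun x y => ?_, fun x => ?_, fun x y hxy => ?_⟩
  · exact mul_nonneg (Real.exp_pos _).le (hasSum_exp_apply (t • A) x y |>.nonneg (hterm x y))
  · have h := le_hasSum (hasSum_exp_apply (t • A) x x) 0 (fun n _ => hterm x x n)
    have h2 := mul_le_mul_of_nonneg_left h (Real.exp_pos (t * c)).le
    simpa using h2
  · have h := le_hasSum (hasSum_exp_apply (t • A) x y) 1 (fun n _ => hterm x y n)
    have h2 := mul_le_mul_of_nonneg_left h (Real.exp_pos (t * c)).le
    simpa [hAr x y hxy] using h2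

theorem transitionMatrix_nonneg {r : S → S → ℝ} (hr : ∀ x y, x ≠ y → 0 ≤ r x y) {t : ℝ}
    (ht : 0 ≤ t) (x y : S) : 0 ≤ transitionMatrix (generatorOfRates r) t x y := by
  obtain ⟨e, -, h, -⟩ := transitionMatrix_ge hr ht
  exact h x y

theorem transitionMatrix_pos_of_reflTransGen {r : S → S → ℝ} (hr : ∀ x y, x ≠ y → 0 ≤ r x y)
    {x y : S} (h : Relation.ReflTransGen (fun a b => a ≠ b ∧ 0 < r a b) x y) {t : ℝ}
    (ht : 0 < t) : 0 < transitionMatrix (generatorOfRates r) t x y := by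
  induction h using Relation.ReflTransGen.head_induction_on generalizing t with
  | refl =>
    obtain ⟨e, he, -, h, -⟩ := transitionMatrix_ge hr ht.le
    exact he.trans_le (h y)
  | @head a b hab _ ih =>
    rw [← add_halves t, transitionMatrix_add, Matrix.mul_apply]
    obtain ⟨e, he, h0, -, h⟩ := transitionMatrix_ge hr (half_pos ht).le
    have h1 : 0 < transitionMatrix (generatorOfRates r) (t / 2) a b := by
      refine lt_of_lt_of_le ?_ (h a b hab.1)
      have := hab.2
      positivity
    exact (mul_pos h1 (ih (half_pos ht))).trans_le
      (Finset.single_le_sum (f := fun z => transitionMatrix (generatorOfRates r) (t / 2) a z *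
        transitionMatrix (generatorOfRates r) (t / 2) z y)
        (fun z _ => mul_nonneg (h0 a z) (h0 z y)) (Finset.mem_univ b))

/-- Doeblin's contraction estimate. -/
theorem sum_abs_mul_le_of_minorization {P : Matrix S S ℝ} {x₀ : S} {δ : ℝ}
    (h0 : ∀ x y, 0 ≤ P x y) (h1 : ∀ x, ∑ y, P x y = 1) (hδ : ∀ x, δ ≤ P x x₀) {u : S → ℝ}
    (hu : ∑ x, u x = 0) : ∑ y, |∑ x, u x * P x y| ≤ (1 - δ) * ∑ x, |u x| := by
  -- The part of `P` common to all rows is invisible to a vector of total mass zero; the remainder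
  -- is nonnegative with row sums 1 - δ.
  set R : S → S → ℝ := fun x y => P x y - if y = x₀ then δ else 0 with hR
  have hR0 : ∀ x y, 0 ≤ R x y := by
    intro x y
    simp only [hR]
    split_ifs with h
    · subst h; linarith [hδ x]
    · simpa using h0 x y
  have hRs : ∀ x, ∑ y, R x y = 1 - δ := by
    intro x
    simp [hR, Finset.sum_sub_distrib, h1]
  have hPR : ∀ y, ∑ x, u x * P x y = ∑ x, u x * R x y := by
    intro y
    simp only [hR, mul_sub, Finset.sum_sub_distrib, ← Finset.sum_mul, hu]
    simp
  calc ∑ y, |∑ x, u x * P x y| = ∑ y, |∑ x, u x * R x y| := by simp_rw [hPR]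
    _ ≤ ∑ y, ∑ x, |u x| * R x y := by
        refine Finset.sum_le_sum fun y _ => (Finset.abs_sum_le_sum_abs _ _).trans_eq ?_
        exact Finset.sum_congr rfl fun x _ => by rw [abs_mul, abs_of_nonneg (hR0 x y)]
    _ = (1 - δ) * ∑ x, |u x| := by
        rw [Finset.sum_comm]
        simp_rw [← Finset.mul_sum, hRs, ← Finset.sum_mul]
        ring

theorem tendsto_sum_mul_transitionMatrix_zero {r : S → S → ℝ} (hr : ∀ x y, x ≠ y → 0 ≤ r x y)
    {x₀ : S} (hx₀ : ∀ x, Relation.ReflTransGen (fun a b => a ≠ b ∧ 0 < r a b) x x₀)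
    {u : S → ℝ} (hu : ∑ x, u x = 0) :
    Tendsto (fun t : ℝ≥0 => ∑ y, |∑ x, u x * transitionMatrix (generatorOfRates r) t x y|)
      atTop (𝓝 0) := by
  set P := transitionMatrix (generatorOfRates r)
  have h0 : ∀ {t : ℝ}, 0 ≤ t → ∀ x y, 0 ≤ P t x y := fun ht => transitionMatrix_nonneg hr ht
  have h1 : ∀ t x, ∑ y, P t x y = 1 := sum_transitionMatrix (sum_generatorOfRates r)
  have hsum : ∀ t, ∑ y, ∑ x, u x * P t x y = 0 := by
    intro t
    rw [Finset.sum_comm]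
    simp_rw [← Finset.mul_sum, h1]
    simpa using hu
  have hstep : ∀ s t y, ∑ x, u x * P (s + t) x y = ∑ z, (∑ x, u x * P s x z) * P t z y := by
    intro s t y
    simp_rw [P, transitionMatrix_add, Matrix.mul_apply, Finset.mul_sum, Finset.sum_mul]
    rw [Finset.sum_comm]
    simp_rw [mul_assoc]
  have : Nonempty S := ⟨x₀⟩
  obtain ⟨x₁, hx₁⟩ := Finite.exists_min (fun x => P 1 x x₀)
  set δ := P 1 x₁ x₀
  have hδ : 0 < δ := transitionMatrix_pos_of_reflTransGen hr (hx₀ x₁) one_pos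
  have hδ1 : δ ≤ 1 := by
    rw [← h1 1 x₁]
    exact Finset.single_le_sum (f := fun y => P 1 x₁ y) (fun y _ => h0 zero_le_one x₁ y)
      (Finset.mem_univ x₀)
  set f : ℝ → ℝ := fun t => ∑ y, |∑ x, u x * P t x y| with hf
  -- With δ = 0 the Doeblin estimate says that the ℓ¹ norm never increases; this handles the
  -- fractional part of t.
  have hmono : ∀ s t, 0 ≤ t → f (s + t) ≤ f s := by
    intro s t ht
    have := sum_abs_mul_le_of_minorization (δ := 0) (x₀ := x₀) (h0 ht) (h1 t)
      (fun x => h0 ht x x₀) (hsum s)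
    simp only [hf, hstep]
    simpa using this
  have hcontr : ∀ n : ℕ, f n ≤ (1 - δ) ^ n * f 0 := by
    intro n
    induction n with
    | zero => simp
    | succ n ih =>
      have := sum_abs_mul_le_of_minorization (h0 zero_le_one) (h1 1) hx₁ (hsum n)
      simp only [← hstep] at this
      push_cast
      calc f (n + 1) ≤ (1 - δ) * f n := this
        _ ≤ (1 - δ) * ((1 - δ) ^ n * f 0) := by gcongr
        _ = _ := by ring
  have hlim : Tendsto (fun t : ℝ≥0 => (1 - δ) ^ ⌊t⌋₊ * f 0) atTop (𝓝 0) := by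
    have := (tendsto_pow_atTop_nhds_zero_of_lt_one (r := 1 - δ) (by linarith) (by linarith)).comp
      (tendsto_nat_floor_atTop (α := ℝ≥0))
    simpa using this.mul_const (f 0)
  refine squeeze_zero (fun t => Finset.sum_nonneg fun _ _ => abs_nonneg _) (fun t => ?_) hlim
  refine le_trans ?_ (hcontr ⌊t⌋₊)
  have h := hmono ⌊t⌋₊ ((t : ℝ) - ⌊t⌋₊)
    (sub_nonneg.2 (by exact_mod_cast Nat.floor_le t.2))
  simpa using h

/-- The constants are a right null vector of the generator, so there is a nonzero left null vector
w, possibly of mixed sign. By the triangle inequality |w| ≤ |w|P_t entrywise; both sides have the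
same total, so they agree, and |w| can be normalized. -/
theorem exists_invariant_probability {r : S → S → ℝ} (hr : ∀ x y, x ≠ y → 0 ≤ r x y)
    [Nonempty S] : ∃ v : S → ℝ, (∀ x, 0 ≤ v x) ∧ ∑ x, v x = 1 ∧
      ∀ t : ℝ≥0, ∀ y, ∑ x, v x * transitionMatrix (generatorOfRates r) t x y = v y := by
  have hdet : (generatorOfRates r).det = 0 := by
    rw [← Matrix.exists_mulVec_eq_zero_iff]
    refine ⟨fun _ => 1, ?_, ?_⟩
    · exact fun h => one_ne_zero (congrFun h (Classical.arbitrary S))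
    · ext x
      simpa [Matrix.mulVec, dotProduct] using sum_generatorOfRates r x
  obtain ⟨w, hw0, hw⟩ := Matrix.exists_vecMul_eq_zero_iff.2 hdet
  have hw' : ∀ t y, ∑ x, w x * transitionMatrix (generatorOfRates r) t x y = w y :=
    sum_mul_transitionMatrix_of_null fun y => by
      simpa [Matrix.vecMul, dotProduct] using congrFun hw y
  have hpos : 0 < ∑ x, |w x| := by
    obtain ⟨x, hx⟩ := Function.ne_iff.1 hw0
    exact Finset.sum_pos' (fun _ _ => abs_nonneg _) ⟨x, Finset.mem_univ x, abs_pos.2 hx⟩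
  have habs : ∀ t : ℝ≥0, ∀ y,
      ∑ x, |w x| * transitionMatrix (generatorOfRates r) t x y = |w y| := by
    intro t
    have hle : ∀ y ∈ Finset.univ,
        |w y| ≤ ∑ x, |w x| * transitionMatrix (generatorOfRates r) t x y := by
      intro y _
      conv_lhs => rw [← hw' t y]
      refine (Finset.abs_sum_le_sum_abs _ _).trans_eq ?_
      exact Finset.sum_congr rfl fun x _ => by
        rw [abs_mul]
        exact congrArg (_ * ·) (abs_of_nonneg (transitionMatrix_nonneg hr t.2 x y))
    have hsum : ∑ y, |w y| = ∑ y, ∑ x, |w x| * transitionMatrix (generatorOfRates r) t x y := by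
      rw [Finset.sum_comm]
      simp_rw [← Finset.mul_sum, sum_transitionMatrix (sum_generatorOfRates r)]
      simp
    intro y
    exact ((Finset.sum_eq_sum_iff_of_le hle).1 hsum y (Finset.mem_univ y)).symm
  refine ⟨fun x => |w x| / ∑ x, |w x|, fun x => by positivity, ?_, fun t y => ?_⟩
  · rw [← Finset.sum_div, div_self hpos.ne']
  · simp_rw [div_mul_eq_mul_div, ← Finset.sum_div, habs]

/-- The law at time `t` of a Markov process with generator `G` and initial law `p`. -/
noncomputable def lawAt (G : Matrix S S ℝ) (p : S → ℝ) (t : ℝ) (y : S) : ℝ :=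
  ∑ x, p x * transitionMatrix G t x y

theorem lawAt_nonneg {r : S → S → ℝ} (hr : ∀ x y, x ≠ y → 0 ≤ r x y) {p : S → ℝ}
    (hp0 : ∀ x, 0 ≤ p x) {t : ℝ} (ht : 0 ≤ t) (y : S) : 0 ≤ lawAt (generatorOfRates r) p t y :=
  Finset.sum_nonneg fun x _ => mul_nonneg (hp0 x) (transitionMatrix_nonneg hr ht x y)

theorem sum_lawAt (r : S → S → ℝ) {p : S → ℝ} (hp1 : ∑ x, p x = 1) (t : ℝ) :
    ∑ y, lawAt (generatorOfRates r) p t y = 1 := by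
  unfold lawAt
  rw [Finset.sum_comm]
  simp_rw [← Finset.mul_sum, sum_transitionMatrix (sum_generatorOfRates r)]
  simpa using hp1

/-- Gronwall estimate for the expectation of a time-dependent Lyapunov function. -/
theorem sum_lawAt_mul_le {r : S → S → ℝ} (hr : ∀ x y, x ≠ y → 0 ≤ r x y)
    {p : S → ℝ} (hp0 : ∀ x, 0 ≤ p x) (hp1 : ∑ x, p x = 1) {f f' : ℝ → S → ℝ} {a c : ℝ}
    (ha : 0 < a) (hc : 0 ≤ c)
    (hf : ∀ t, 0 ≤ t → ∀ y, HasDerivWithinAt (fun t => f t y) (f' t y) (Set.Ici 0) t)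
    (hL : ∀ t, 0 ≤ t → ∀ y, ∑ z, r y z * (f t z - f t y) + f' t y ≤ -a * f t y + c)
    {t : ℝ} (ht : 0 ≤ t) :
    ∑ y, lawAt (generatorOfRates r) p t y * f t y ≤
      Real.exp (-(a * t)) * (∑ x, p x * f 0 x) + c / a := by
  set G := generatorOfRates r
  set π : ℝ → S → ℝ := lawAt G p with hπ
  have hπ0 : ∀ t, 0 ≤ t → ∀ y, 0 ≤ π t y := fun t ht y => lawAt_nonneg hr hp0 ht y
  have hπ1 : ∀ t, ∑ y, π t y = 1 := sum_lawAt r hp1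
  have hπd : ∀ t y, HasDerivAt (fun t => π t y) (∑ z, π t z * G z y) t := by
    intro t y
    have h := HasDerivAt.fun_sum (u := Finset.univ) fun x _ =>
      (hasDerivAt_transitionMatrix G t x y).const_mul (p x)
    refine h.congr_deriv ?_
    simp_rw [hπ, lawAt, Finset.mul_sum, Finset.sum_mul]
    rw [Finset.sum_comm]
    simp_rw [mul_assoc]
  set E : ℝ → ℝ := fun t => ∑ y, π t y * f t y with hE
  have hEd : ∀ t, 0 ≤ t → HasDerivWithinAt E
      (∑ y, π t y * (∑ z, r y z * (f t z - f t y) + f' t y)) (Set.Ici 0) t := by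
    intro t ht
    have h := HasDerivWithinAt.fun_sum (u := Finset.univ) fun y _ =>
      (hπd t y).hasDerivWithinAt.fun_mul (hf t ht y)
    refine h.congr_deriv ?_
    simp_rw [mul_add, Finset.sum_add_distrib]
    congr 1
    simp_rw [← generatorOfRates_mulVec, Finset.mul_sum, Finset.sum_mul]
    rw [Finset.sum_comm]
    simp_rw [G, mul_assoc]
  have hEle : ∀ t, 0 ≤ t → ∑ y, π t y * (∑ z, r y z * (f t z - f t y) + f' t y) ≤
      -a * E t + c := by
    intro t ht
    calc _ ≤ ∑ y, π t y * (-a * f t y + c) :=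
          Finset.sum_le_sum fun y _ => mul_le_mul_of_nonneg_left (hL t ht y) (hπ0 t ht y)
      _ = _ := by
          simp_rw [mul_add, Finset.sum_add_distrib, ← Finset.sum_mul, hπ1, hE, Finset.mul_sum]
          simp [mul_left_comm]
  -- c / a is the equilibrium of E' = -aE + c, so the differential inequality makes `g`
  -- nonincreasing.
  set g : ℝ → ℝ := fun t => Real.exp (a * t) * (E t - c / a) with hg
  have hgd : ∀ t, 0 ≤ t → HasDerivWithinAt g (a * Real.exp (a * t) * (E t - c / a) +
      Real.exp (a * t) * (∑ y, π t y * (∑ z, r y z * (f t z - f t y) + f' t y)))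
      (Set.Ici 0) t := by
    intro t ht
    have h1 : HasDerivAt (fun t => Real.exp (a * t)) (a * Real.exp (a * t)) t := by
      simpa [mul_comm] using ((hasDerivAt_id t).const_mul a).exp
    exact h1.hasDerivWithinAt.fun_mul ((hEd t ht).sub_const (c / a))
  have hanti : AntitoneOn g (Set.Ici 0) := by
    refine antitoneOn_of_hasDerivWithinAt_nonpos (convex_Ici 0)
      (fun t ht => (hgd t ht).continuousWithinAt)
      (fun t ht => (hgd t (interior_subset ht)).mono interior_subset) fun t ht => ?_
    have h1 := hEle t (interior_subset ht)
    have h2 : a * (c / a) = c := by field_simp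
    have h3 := Real.exp_pos (a * t)
    nlinarith [mul_le_mul_of_nonneg_left h1 h3.le]
  have h := hanti (Set.self_mem_Ici) (Set.mem_Ici.2 ht) ht
  have hE0 : E 0 = ∑ x, p x * f 0 x := by
    simp [hE, hπ, lawAt, transitionMatrix_zero, Matrix.one_apply]
  simp only [hg, mul_zero, Real.exp_zero, one_mul, hE0] at h
  have h2 : E t - c / a ≤ Real.exp (-(a * t)) * (∑ x, p x * f 0 x - c / a) := by
    rw [Real.exp_neg, inv_mul_eq_div, le_div_iff₀ (Real.exp_pos _)]
    linarith
  have h3 : 0 ≤ Real.exp (-(a * t)) * (c / a) := by positivity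
  change E t ≤ _
  linarith

end MarkovChain

/-! ### Jumps and generator of the charging station. -/

section Station

variable {N : ℕ}

theorem State.ext_total_uncharged {s s' : State N} (h1 : total s = total s')
    (h2 : uncharged s = uncharged s') : s = s' :=
  Subtype.ext (Prod.ext (Fin.ext h1) (Fin.ext h2))

theorem uncharged_le_total (s : State N) : uncharged s ≤ total s := s.2

theorem total_le (s : State N) : total s ≤ N := Nat.lt_succ_iff.1 s.1.1.2

theorem exists_state {a b : ℕ} (hb : b ≤ a) (ha : a ≤ N) :
    ∃ s : State N, total s = a ∧ uncharged s = b :=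
  ⟨⟨(⟨a, by omega⟩, ⟨b, by omega⟩), hb⟩, rfl, rfl⟩

theorem jumpRate_nonneg {lam mu nu M : ℝ} (hlam : 0 ≤ lam) (hmu : 0 ≤ mu) (hnu : 0 ≤ nu)
    (hM : 0 ≤ M) (s s' : State N) : 0 ≤ jumpRate lam mu nu M s s' := by
  have h : (uncharged s : ℝ) ≤ total s := by exact_mod_cast uncharged_le_total s
  have h' : 0 ≤ (total s : ℝ) - uncharged s := by linarith
  unfold jumpRate allocation
  split_ifs <;> positivity

theorem reflTransGen_jumpRate {lam mu nu M : ℝ} (hnu : 0 < nu) {s₀ : State N}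
    (hs₀ : total s₀ = 0) (s : State N) : Relation.ReflTransGen
      (fun a b => a ≠ b ∧ 0 < jumpRate lam mu nu M a b) s s₀ := by
  obtain ⟨k, hk⟩ : ∃ k, total s = k := ⟨_, rfl⟩
  induction k generalizing s with
  | zero =>
    have h1 := uncharged_le_total s
    have h2 := uncharged_le_total s₀
    rw [State.ext_total_uncharged (s := s) (s' := s₀) (by omega) (by omega)]
  | succ k ih =>
    have h1 := uncharged_le_total s
    have h2 := total_le s
    -- Truncated subtraction covers both cases: an uncharged vehicle leaves if there is one,
    -- otherwise a charged one.
    obtain ⟨s', ht, hu⟩ := exists_state (N := N) (a := k) (b := uncharged s - 1)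
      (by omega) (by omega)
    refine Relation.ReflTransGen.head ⟨?_, ?_⟩ (ih s' ht)
    · rintro rfl
      omega
    · unfold jumpRate
      rw [if_neg (by omega), if_neg (by omega)]
      by_cases hz : uncharged s = 0
      · rw [if_neg (by omega), if_pos (by omega), hz, hk]
        push_cast
        have : (0 : ℝ) < k + 1 := by positivity
        simpa using mul_pos hnu this
      · rw [if_pos (by omega)]
        have : (0 : ℝ) < uncharged s := by exact_mod_cast Nat.pos_of_ne_zero hz
        positivity

theorem sum_ite_state {a b : ℕ} (hb : b ≤ a) (ha : a ≤ N) (c : ℝ) (F : State N → ℝ)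
    (φ : ℝ → ℝ → ℝ) (hF : ∀ s, F s = φ (total s) (uncharged s)) (P : State N → Prop)
    [DecidablePred P] (hP : ∀ s, P s ↔ total s = a ∧ uncharged s = b) :
    ∑ s, (if P s then c else 0) * F s = c * φ a b := by
  obtain ⟨s₁, h1, h2⟩ := exists_state (N := N) hb ha
  rw [Finset.sum_eq_single s₁, if_pos ((hP s₁).2 ⟨h1, h2⟩), hF, h1, h2]
  · intro s _ hs
    rw [if_neg, zero_mul]
    intro h
    obtain ⟨h3, h4⟩ := (hP s).1 h
    exact hs (State.ext_total_uncharged (by omega) (by omega))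
  · simp

/-- Whenever the target of a charging or departure jump is not a state, its rate is zero, so no
boundary correction arises there. Only arrivals are truly cut off, hence the single indicator. -/
theorem sum_jumpRate_mul (lam mu nu : ℝ) {M : ℝ} (hM : 0 ≤ M) (φ : ℝ → ℝ → ℝ) (s : State N) :
    ∑ s', jumpRate lam mu nu M s s' *
        (φ (total s') (uncharged s') - φ (total s) (uncharged s)) =
      lam * (if total s < N then 1 else 0) *
          (φ (total s + 1) (uncharged s + 1) - φ (total s) (uncharged s)) +
        mu * min (uncharged s : ℝ) M *
          (φ (total s) (uncharged s - 1) - φ (total s) (uncharged s)) +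
        nu * uncharged s * (φ (total s - 1) (uncharged s - 1) - φ (total s) (uncharged s)) +
        nu * ((total s : ℝ) - uncharged s) *
          (φ (total s - 1) (uncharged s) - φ (total s) (uncharged s)) := by
  have hle := uncharged_le_total s
  have hN := total_le s
  set F : State N → ℝ := fun s' => φ (total s') (uncharged s') - φ (total s) (uncharged s) with hF
  -- The four jump conditions exclude one another, so the nested conditional is a sum.
  have hsplit : ∀ s', jumpRate lam mu nu M s s' =
      (if total s' = total s + 1 ∧ uncharged s' = uncharged s + 1 then lam else 0) +
      (if total s' = total s ∧ uncharged s = uncharged s' + 1 then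
        mu * min (uncharged s : ℝ) M else 0) +
      (if total s = total s' + 1 ∧ uncharged s = uncharged s' + 1 then
        nu * uncharged s else 0) +
      (if total s = total s' + 1 ∧ uncharged s' = uncharged s then
        nu * ((total s : ℝ) - uncharged s) else 0) := by
    intro s'
    unfold jumpRate allocation
    by_cases h1 : total s' = total s + 1 ∧ uncharged s' = uncharged s + 1
    · rw [if_pos h1, if_pos h1, if_neg (by omega), if_neg (by omega), if_neg (by omega)]; ring
    by_cases h2 : total s' = total s ∧ uncharged s = uncharged s' + 1
    · rw [if_neg h1, if_pos h2, if_neg h1, if_pos h2, if_neg (by omega), if_neg (by omega)]; ring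
    by_cases h3 : total s = total s' + 1 ∧ uncharged s = uncharged s' + 1
    · rw [if_neg h1, if_neg h2, if_pos h3, if_neg h1, if_neg h2, if_pos h3, if_neg (by omega)]
      ring
    · rw [if_neg h1, if_neg h2, if_neg h3, if_neg h1, if_neg h2, if_neg h3]; ring
  set ψ : ℝ → ℝ → ℝ := fun u v => φ u v - φ (total s) (uncharged s) with hψ
  have hFφ : ∀ s', F s' = ψ (total s') (uncharged s') := fun _ => rfl
  have hdrop : ∀ (P : State N → Prop) [DecidablePred P], (∀ s', ¬ P s') → ∀ c : ℝ,
      ∑ s', (if P s' then c else 0) * F s' = 0 := fun P _ hP c =>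
    Finset.sum_eq_zero fun s' _ => by rw [if_neg (hP s'), zero_mul]
  change ∑ s', jumpRate lam mu nu M s s' * F s' = _
  simp_rw [hsplit, add_mul, Finset.sum_add_distrib]
  congr 1
  congr 1
  congr 1
  · by_cases hq : total s < N
    · rw [sum_ite_state (a := total s + 1) (b := uncharged s + 1) (by omega) (by omega) _ F ψ hFφ
        _ (fun s' => Iff.rfl), if_pos hq, mul_one]
      push_cast
      rfl
    · rw [hdrop _ (fun s' => by have := total_le s'; omega), if_neg hq]
      ring
  · rcases Nat.eq_zero_or_pos (uncharged s) with hz | hz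
    · rw [hdrop _ (fun s' => by omega), hz]
      simp [hM]
    · rw [sum_ite_state (a := total s) (b := uncharged s - 1) (by omega) (by omega) _ F ψ hFφ
        _ (fun s' => by omega), Nat.cast_sub hz]
      push_cast
      rfl
  · rcases Nat.eq_zero_or_pos (uncharged s) with hz | hz
    · rw [hdrop _ (fun s' => by omega), hz]
      simp
    · rw [sum_ite_state (a := total s - 1) (b := uncharged s - 1) (by omega) (by omega) _ F ψ hFφ
        _ (fun s' => by omega), Nat.cast_sub hz, Nat.cast_sub (by omega)]
      push_cast
      rfl
  · rcases hle.eq_or_lt with hz | hz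
    · rw [Finset.sum_eq_zero, hz]
      · simp
      · intro s' _
        rw [hz]
        simp
    · rw [sum_ite_state (a := total s - 1) (b := uncharged s) (by omega) (by omega) _ F ψ hFφ
        _ (fun s' => by omega), Nat.cast_sub (by omega)]
      push_cast
      rfl

end Station

/-! ### Fluid scaling of the generator. -/

section Scaling

variable {K : ℕ}

theorem scaledUncharged_nonneg (n : ℕ+) (s : State (n * K)) : 0 ≤ scaledUncharged n s := by
  unfold scaledUncharged; positivity

theorem scaledUncharged_le_scaledTotal (n : ℕ+) (s : State (n * K)) :
    scaledUncharged n s ≤ scaledTotal n s := by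
  unfold scaledUncharged scaledTotal
  have : (uncharged s : ℝ) ≤ total s := by exact_mod_cast uncharged_le_total s
  gcongr

theorem pnat_cast_pos (n : ℕ+) : (0 : ℝ) < n := by exact_mod_cast n.pos

theorem scaledTotal_le (n : ℕ+) (s : State (n * K)) : scaledTotal n s ≤ K := by
  unfold scaledTotal
  rw [div_le_iff₀ (pnat_cast_pos n)]
  have : (total s : ℝ) ≤ ((n * K : ℕ) : ℝ) := by exact_mod_cast total_le s
  push_cast at this
  linarith

/-- `1` if a vehicle can still enter the station, `0` if the station is full. -/
noncomputable def admission (n : ℕ+) (s : State (n * K)) : ℝ :=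
  if total s < n * K then 1 else 0

theorem admission_cases (n : ℕ+) (s : State (n * K)) :
    admission n s = 1 ∨ (admission n s = 0 ∧ scaledTotal n s = K) := by
  unfold admission
  split_ifs with h
  · exact Or.inl rfl
  · refine Or.inr ⟨rfl, ?_⟩
    have h1 : total s = n * K := le_antisymm (total_le s) (not_lt.1 h)
    unfold scaledTotal
    rw [h1]
    have := pnat_cast_pos n
    push_cast
    field_simp

theorem sum_scaled_jumpRate_mul (lam mu nu : ℝ) {M : ℝ} (hM : 0 ≤ M) (n : ℕ+) (φ : ℝ → ℝ → ℝ)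
    (s : State (n * K)) {x y h : ℝ} (hx : scaledTotal n s = x) (hy : scaledUncharged n s = y)
    (hh : h = 1 / (n : ℝ)) :
    ∑ s', jumpRate (n * lam) mu nu (n * M) s s' *
        (φ (scaledTotal n s') (scaledUncharged n s') - φ (scaledTotal n s) (scaledUncharged n s)) =
      n * (lam * admission n s * (φ (x + h) (y + h) - φ x y) +
        mu * min y M * (φ x (y - h) - φ x y) +
        nu * y * (φ (x - h) (y - h) - φ x y) +
        nu * (x - y) * (φ (x - h) y - φ x y)) := by
  have hn := pnat_cast_pos n
  have hsum := sum_jumpRate_mul (n * lam) mu nu (mul_nonneg hn.le hM)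
    (fun u v => φ (u / n) (v / n)) s
  unfold scaledTotal at *
  unfold scaledUncharged at *
  have hx' : (total s : ℝ) = n * x := by rw [← hx]; field_simp
  have hy' : (uncharged s : ℝ) = n * y := by rw [← hy]; field_simp
  rw [hsum, hx', hy', ← mul_min_of_nonneg _ _ hn.le]
  have e1 : ∀ u : ℝ, ((n : ℝ) * u + 1) / n = u + h := fun u => by rw [hh]; field_simp
  have e2 : ∀ u : ℝ, ((n : ℝ) * u - 1) / n = u - h := fun u => by rw [hh]; field_simp
  have e3 : ∀ u : ℝ, (n * u) / n = u := fun u => by field_simp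
  simp only [e1, e2, e3, admission]
  ring

end Scaling

/-! ### Lyapunov functions and mean square bounds uniform in time. -/

section Lyapunov

variable {lam mu nu M : ℝ} {K : ℕ}

/-- Reduces the probabilistic estimate to a real inequality in x = Q/n, y = Z/n, the admission
indicator i and the jump size h = 1/n. All that is kept of blocking is that i = 0 forces x = K. -/
theorem lyapunov_scaled (hlam : 0 < lam) (hmu : 0 < mu) (hnu : 0 < nu) (hM : 0 < M)
    {φ φ' : ℝ → ℝ → ℝ → ℝ} {C : ℝ} (hC : 0 ≤ C)
    (hd : ∀ t, 0 ≤ t → ∀ x y, HasDerivWithinAt (fun t => φ t x y) (φ' t x y) (Set.Ici 0) t)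
    (hL : ∀ t x y i h : ℝ, 0 ≤ t → 0 ≤ y → y ≤ x → x ≤ K → 0 < h → (i = 1 ∨ i = 0 ∧ x = K) →
      h⁻¹ * (lam * i * (φ t (x + h) (y + h) - φ t x y) +
        mu * min y M * (φ t x (y - h) - φ t x y) +
        nu * y * (φ t (x - h) (y - h) - φ t x y) +
        nu * (x - y) * (φ t (x - h) y - φ t x y)) + φ' t x y ≤ -nu * φ t x y + C * h)
    (n : ℕ+) {p : State (n * K) → ℝ} (hp0 : ∀ x, 0 ≤ p x) (hp1 : ∑ x, p x = 1)
    {t : ℝ} (ht : 0 ≤ t) :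
    ∑ s, lawAt (scaledGenerator lam mu nu M K n) p t s *
        φ t (scaledTotal n s) (scaledUncharged n s) ≤
      Real.exp (-(nu * t)) * (∑ s, p s * φ 0 (scaledTotal n s) (scaledUncharged n s)) +
        C / nu * (1 / n) := by
  have hn := pnat_cast_pos n
  have h := sum_lawAt_mul_le
    (fun x y _ => jumpRate_nonneg (N := n * K) (mul_pos hn hlam).le hmu.le hnu.le
      (mul_pos hn hM).le x y) hp0 hp1
    (f := fun t s => φ t (scaledTotal n s) (scaledUncharged n s))
    (f' := fun t s => φ' t (scaledTotal n s) (scaledUncharged n s)) (a := nu) (c := C * (1 / n))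
    hnu (by positivity) (fun t ht s => hd t ht _ _) (fun t ht s => ?_) ht
  · refine h.trans_eq ?_
    ring
  · rw [sum_scaled_jumpRate_mul lam mu nu hM.le n (φ t) s rfl rfl rfl]
    have := hL t (scaledTotal n s) (scaledUncharged n s) (admission n s) (1 / n) ht
      (scaledUncharged_nonneg n s) (scaledUncharged_le_scaledTotal n s) (scaledTotal_le n s)
      (by positivity) (admission_cases n s)
    rw [one_div] at this ⊢
    rwa [inv_inv] at this

/-- Meant for a = y, b = z, with d the deviation of the charged vehicles and W = K - x the free
space. For d ≥ 0 monotonicity makes the left side nonpositive; for d < 0 one has b ≤ a + W, and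
min(·, M) is 1-Lipschitz. -/
theorem sub_mul_min_sub_le (a b M W d : ℝ) (hW : 0 ≤ W) (h : a - b = -W - d) :
    d * (min a M - min b M) ≤ |d| * W := by
  rcases le_total 0 d with hd | hd
  · have h1 : min a M ≤ min b M := min_le_min_right M (by linarith)
    have h2 : 0 ≤ |d| * W := by positivity
    nlinarith
  · rw [abs_of_nonpos hd]
    have h1 : min b M ≤ min a M + W := by
      rcases min_choice a M with h' | h' <;> rw [h']
      · exact (min_le_left _ _).trans (by linarith)
      · exact (min_le_right _ _).trans (by linarith)
    nlinarith

theorem sub_mul_min_sub_nonneg (a b M : ℝ) : 0 ≤ (a - b) * (min a M - min b M) := by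
  rcases le_total a b with h | h
  · exact mul_nonneg_of_nonpos_of_nonpos (by linarith) (by linarith [min_le_min_right M h])
  · exact mul_nonneg (by linarith) (by linarith [min_le_min_right M h])

/-- The charged count x - y has no arrival term, hence no blocking. Its price is an error 2μ|d|W,
absorbed by the drift of cW²: free space W shrinks at least at rate νW while λ ≥ νK, and blocking
occurs only at W = 0. -/
theorem drift_charged_saturated (hlam : 0 < lam) (hmu : 0 < mu) (hnu : 0 < nu)
    (hsat : nu * K ≤ lam) {x y i h z c : ℝ} (hc : c = mu ^ 2 / nu ^ 2) (hy : 0 ≤ y) (hyx : y ≤ x)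
    (hxK : x ≤ K) (hh : 0 < h) (hi : i = 1 ∨ i = 0 ∧ x = K) :
    h⁻¹ * (lam * i * (((x + h - (y + h) - (K - z)) ^ 2 + c * (K - (x + h)) ^ 2) -
          ((x - y - (K - z)) ^ 2 + c * (K - x) ^ 2)) +
        mu * min y M * (((x - (y - h) - (K - z)) ^ 2 + c * (K - x) ^ 2) -
          ((x - y - (K - z)) ^ 2 + c * (K - x) ^ 2)) +
        nu * y * (((x - h - (y - h) - (K - z)) ^ 2 + c * (K - (x - h)) ^ 2) -
          ((x - y - (K - z)) ^ 2 + c * (K - x) ^ 2)) +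
        nu * (x - y) * (((x - h - y - (K - z)) ^ 2 + c * (K - (x - h)) ^ 2) -
          ((x - y - (K - z)) ^ 2 + c * (K - x) ^ 2))) +
      2 * (x - y - (K - z)) * (nu * K - nu * z - mu * min z M) ≤
    -nu * ((x - y - (K - z)) ^ 2 + c * (K - x) ^ 2) +
      (c * lam + mu * K + nu * K * c + nu * K) * h := by
  obtain ⟨d, hd⟩ : ∃ d, d = x - y - (K - z) := ⟨_, rfl⟩
  obtain ⟨W, hW⟩ : ∃ W, W = K - x := ⟨_, rfl⟩
  have hW0 : 0 ≤ W := by linarith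
  have hc0 : 0 < c := by rw [hc]; positivity
  have hm : min y M ≤ K := (min_le_left _ _).trans (hyx.trans hxK)
  have hcn : c * nu ^ 2 = mu ^ 2 := by rw [hc]; field_simp
  -- Clears h⁻¹, so that the exact expansion becomes a polynomial identity.
  have e := fun A B => (inv_mul_eq_iff_eq_mul₀ (a := h) (b := A) (c := B) hh.ne').2
  rw [e _ (lam * i * (c * (h - 2 * W)) + mu * min y M * (2 * d + h) +
    nu * y * (c * (2 * W + h)) + nu * (x - y) * (h - 2 * d + c * (2 * W + h)))
    (by rw [hd, hW]; ring)]
  have e2 : lam * i * (c * (h - 2 * W)) + mu * min y M * (2 * d + h) +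
      nu * y * (c * (2 * W + h)) + nu * (x - y) * (h - 2 * d + c * (2 * W + h)) +
      2 * (x - y - (K - z)) * (nu * K - nu * z - mu * min z M) =
      2 * mu * (d * (min y M - min z M)) - 2 * nu * d ^ 2 + 2 * c * (W * (nu * x - lam * i)) +
      h * (c * (lam * i) + mu * min y M + nu * x * c + nu * (x - y)) := by
    rw [hd, hW]
    ring
  rw [e2, ← hd, ← hW]
  have f1 := sub_mul_min_sub_le y z M W d hW0 (by rw [hd, hW]; ring)
  have f2 : W * (nu * x - lam * i) ≤ -nu * W ^ 2 := by
    rcases hi with h | ⟨h, h'⟩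
    · have : nu * x - lam * i ≤ -nu * W := by rw [h, hW]; linarith
      calc W * (nu * x - lam * i) ≤ W * (-nu * W) := mul_le_mul_of_nonneg_left this hW0
        _ = -nu * W ^ 2 := by ring
    · have : W = 0 := by rw [hW]; linarith
      simp [this]
  have f3 : c * (lam * i) + mu * min y M + nu * x * c + nu * (x - y) ≤
      c * lam + mu * K + nu * K * c + nu * K := by
    have : lam * i ≤ lam := by rcases hi with h | h <;> simp [h, hlam.le]
    gcongr
    linarith
  -- The value c = μ²/ν² is what this weighted AM-GM inequality requires: half of each dissipation
  -- term is spent here.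
  have f4 : 2 * mu * (|d| * W) ≤ nu * d ^ 2 + c * nu * W ^ 2 := by
    have h1 : 0 ≤ (nu * |d| - mu * W) ^ 2 := sq_nonneg _
    have h2 : nu * (2 * mu * (|d| * W)) ≤ nu * (nu * d ^ 2 + c * nu * W ^ 2) := by
      rw [← sq_abs d]
      linear_combination h1 - W ^ 2 * hcn
    exact le_of_mul_le_mul_left h2 hnu
  have f1' := mul_le_mul_of_nonneg_left f1 (mul_pos two_pos hmu).le
  have f2' := mul_le_mul_of_nonneg_left f2 (mul_pos two_pos hc0).le
  have f3' := mul_le_mul_of_nonneg_left f3 hh.le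
  linarith

/-- Blocking contributes 2λ(x - q)(i - 1), which is nonpositive because a full station has x = K ≥
q. -/
theorem drift_total_sq (hlam : 0 < lam) (hnu : 0 < nu)
    {x y i h q m : ℝ} (hxK : x ≤ K) (hqK : q ≤ K) (hh : 0 < h) (hi : i = 1 ∨ i = 0 ∧ x = K) :
    h⁻¹ * (lam * i * ((x + h - q) ^ 2 - (x - q) ^ 2) + m * ((x - q) ^ 2 - (x - q) ^ 2) +
        nu * y * ((x - h - q) ^ 2 - (x - q) ^ 2) +
        nu * (x - y) * ((x - h - q) ^ 2 - (x - q) ^ 2)) + -(2 * (x - q) * (lam - nu * q)) ≤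
    -nu * (x - q) ^ 2 + (lam + nu * K) * h := by
  have e : h⁻¹ * (lam * i * ((x + h - q) ^ 2 - (x - q) ^ 2) + m * ((x - q) ^ 2 - (x - q) ^ 2) +
        nu * y * ((x - h - q) ^ 2 - (x - q) ^ 2) +
        nu * (x - y) * ((x - h - q) ^ 2 - (x - q) ^ 2)) + -(2 * (x - q) * (lam - nu * q)) =
      2 * lam * ((x - q) * (i - 1)) - 2 * nu * (x - q) ^ 2 + h * (lam * i + nu * x) := by
    field_simp
    ring
  rw [e]
  have f1 : (x - q) * (i - 1) ≤ 0 := by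
    rcases hi with h | ⟨h, h'⟩
    · simp [h]
    · rw [h, h']; linarith
  have f2 : lam * i + nu * x ≤ lam + nu * K := by
    have : lam * i ≤ lam := by rcases hi with h | h <;> simp [h, hlam.le]
    gcongr
  have f1' := mul_le_mul_of_nonneg_left f1 (mul_pos two_pos hlam).le
  have f2' := mul_le_mul_of_nonneg_left f2 hh.le
  have f3 : 0 ≤ nu * (x - q) ^ 2 := by positivity
  linarith

/-- In the drift of (y - z)² alone the blocking term has no sign. Adding 2K(x - q) turns it into
2λ(y - z + K)(i - 1) ≤ 0, since y ≥ 0 and z ≤ K. -/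
theorem drift_uncharged_unsaturated (hlam : 0 < lam) (hmu : 0 < mu) (hnu : 0 < nu)
    {x y i h z q : ℝ} (hy : 0 ≤ y) (hyx : y ≤ x) (hzK : z ≤ K)
    (hxK : x ≤ K) (hh : 0 < h) (hi : i = 1 ∨ i = 0 ∧ x = K) :
    h⁻¹ * (lam * i * (((y + h - z) ^ 2 + 2 * K * (x + h - q)) -
          ((y - z) ^ 2 + 2 * K * (x - q))) +
        mu * min y M * (((y - h - z) ^ 2 + 2 * K * (x - q)) -
          ((y - z) ^ 2 + 2 * K * (x - q))) +
        nu * y * (((y - h - z) ^ 2 + 2 * K * (x - h - q)) -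
          ((y - z) ^ 2 + 2 * K * (x - q))) +
        nu * (x - y) * (((y - z) ^ 2 + 2 * K * (x - h - q)) -
          ((y - z) ^ 2 + 2 * K * (x - q)))) +
      (-(2 * (y - z) * (lam - nu * z - mu * min z M)) + -(2 * K * (lam - nu * q))) ≤
    -nu * ((y - z) ^ 2 + 2 * K * (x - q)) + (lam + mu * K + nu * K) * h := by
  have hm : min y M ≤ K := (min_le_left _ _).trans (hyx.trans hxK)
  have e : h⁻¹ * (lam * i * (((y + h - z) ^ 2 + 2 * K * (x + h - q)) -
          ((y - z) ^ 2 + 2 * K * (x - q))) +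
        mu * min y M * (((y - h - z) ^ 2 + 2 * K * (x - q)) -
          ((y - z) ^ 2 + 2 * K * (x - q))) +
        nu * y * (((y - h - z) ^ 2 + 2 * K * (x - h - q)) -
          ((y - z) ^ 2 + 2 * K * (x - q))) +
        nu * (x - y) * (((y - z) ^ 2 + 2 * K * (x - h - q)) -
          ((y - z) ^ 2 + 2 * K * (x - q)))) +
      (-(2 * (y - z) * (lam - nu * z - mu * min z M)) + -(2 * K * (lam - nu * q))) =
      2 * lam * ((y - z + K) * (i - 1)) - 2 * mu * ((y - z) * (min y M - min z M)) -
      2 * nu * (y - z) ^ 2 - nu * (2 * K * (x - q)) +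
      h * (lam * i + mu * min y M + nu * y) := by
    field_simp
    ring
  rw [e]
  have f1 : (y - z + K) * (i - 1) ≤ 0 := by
    rcases hi with h | ⟨h, h'⟩
    · simp [h]
    · rw [h]; linarith
  have f2 : lam * i + mu * min y M + nu * y ≤ lam + mu * K + nu * K := by
    have : lam * i ≤ lam := by rcases hi with h | h <;> simp [h, hlam.le]
    have : y ≤ K := hyx.trans hxK
    gcongr
  have f1' := mul_le_mul_of_nonneg_left f1 (mul_pos two_pos hlam).le
  have f2' := mul_le_mul_of_nonneg_left f2 hh.le
  have f3 : 0 ≤ nu * (y - z) ^ 2 := by positivity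
  have f4 := mul_nonneg (mul_pos two_pos hmu).le (sub_mul_min_sub_nonneg y z M)
  linarith

/-- The variance is nonnegative. -/
theorem abs_sum_mul_le_sqrt {S : Type*} [Fintype S] {p : S → ℝ} (hp0 : ∀ s, 0 ≤ p s)
    (hp1 : ∑ s, p s = 1) (f : S → ℝ) : |∑ s, p s * f s| ≤ √(∑ s, p s * f s ^ 2) := by
  apply Real.abs_le_sqrt
  set m := ∑ s, p s * f s with hm
  have h : 0 ≤ ∑ s, p s * (f s - m) ^ 2 :=
    Finset.sum_nonneg fun s _ => mul_nonneg (hp0 s) (sq_nonneg _)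
  have e : ∑ s, p s * (f s - m) ^ 2 = ∑ s, p s * f s ^ 2 - m ^ 2 := by
    have : ∀ s, p s * (f s - m) ^ 2 = p s * f s ^ 2 - 2 * m * (p s * f s) + m ^ 2 * p s := by
      intro s; ring
    simp_rw [this, Finset.sum_add_distrib, Finset.sum_sub_distrib, ← Finset.mul_sum, hp1, ← hm]
    ring
  linarith

/-- Mean square deviation of `Z / n` from `z` under the weights `p`. -/
noncomputable def msdUncharged (n : ℕ+) (p : State (n * K) → ℝ) (z : ℝ) : ℝ :=
  ∑ s, p s * (scaledUncharged n s - z) ^ 2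

/-- Mean square deviation of `Q / n` from `q` under the weights `p`. -/
noncomputable def msdTotal (n : ℕ+) (p : State (n * K) → ℝ) (q : ℝ) : ℝ :=
  ∑ s, p s * (scaledTotal n s - q) ^ 2

theorem msdUncharged_nonneg (n : ℕ+) {p : State (n * K) → ℝ} (hp0 : ∀ x, 0 ≤ p x) (z : ℝ) :
    0 ≤ msdUncharged n p z := Finset.sum_nonneg fun s _ => mul_nonneg (hp0 s) (sq_nonneg _)

theorem msdTotal_nonneg (n : ℕ+) {p : State (n * K) → ℝ} (hp0 : ∀ x, 0 ≤ p x) (z : ℝ) :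
    0 ≤ msdTotal n p z := Finset.sum_nonneg fun s _ => mul_nonneg (hp0 s) (sq_nonneg _)

theorem msd_bound_saturated (hlam : 0 < lam) (hmu : 0 < mu) (hnu : 0 < nu) (hM : 0 < M)
    (hsat : nu * K ≤ lam) : ∃ C, 0 ≤ C ∧ ∀ z, IsFluidSolution lam mu nu M K z →
      ∀ (n : ℕ+) (p : State (n * K) → ℝ), (∀ s, 0 ≤ p s) → ∑ s, p s = 1 → ∀ t, 0 ≤ t →
      msdUncharged n (lawAt (scaledGenerator lam mu nu M K n) p t) (z t) ≤
        C * (Real.exp (-(nu * t)) * (msdUncharged n p (z 0) + msdTotal n p K) + 1 / n) := by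
  set c := mu ^ 2 / nu ^ 2 with hc
  have hc0 : 0 < c := by positivity
  set C₁ := c * lam + mu * K + nu * K * c + nu * K
  have hC₁ : 0 ≤ C₁ := by positivity
  refine ⟨(2 + 2 / c) * (2 + c + C₁ / nu), by positivity, fun z hz n p hp0 hp1 t ht => ?_⟩
  have hn := pnat_cast_pos n
  have hd : ∀ t, 0 ≤ t → ∀ x y : ℝ, HasDerivWithinAt
      (fun t => (x - y - (K - z t)) ^ 2 + c * (K - x) ^ 2)
      (2 * (x - y - (K - z t)) * (nu * K - nu * z t - mu * min (z t) M)) (Set.Ici 0) t := by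
    intro t ht x y
    have h := hz.hasDeriv t ht
    rw [fluidDrift, min_eq_right hsat, allocation] at h
    refine ((((h.const_sub (K : ℝ)).const_sub (x - y)).fun_pow 2).add_const _).congr_deriv ?_
    push_cast
    ring
  have h := lyapunov_scaled hlam hmu hnu hM hC₁ hd
    (fun t x y i h _ hy hyx hxK hh hi =>
      drift_charged_saturated hlam hmu hnu hsat hc hy hyx hxK hh hi) n hp0 hp1 ht
  set L := lawAt (scaledGenerator lam mu nu M K n) p t
  have hL0 : ∀ s, 0 ≤ L s := lawAt_nonneg (fun x y _ => jumpRate_nonneg (N := n * K)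
    (mul_pos hn hlam).le hmu.le hnu.le (mul_pos hn hM).le x y) hp0 ht
  -- Pointwise (W + d)² ≤ 2d² + 2W², and 2 + 2/c dominates both coefficients once W² carries the
  -- weight c.
  have h1 : msdUncharged n L (z t) ≤ (2 + 2 / c) * ∑ s, L s *
      ((scaledTotal n s - scaledUncharged n s - (K - z t)) ^ 2 +
        c * (K - scaledTotal n s) ^ 2) := by
    rw [msdUncharged, Finset.mul_sum]
    refine Finset.sum_le_sum fun s _ => ?_
    rw [mul_left_comm]
    refine mul_le_mul_of_nonneg_left ?_ (hL0 s)
    set d := scaledTotal n s - scaledUncharged n s - (K - z t) with hdd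
    set W := (K : ℝ) - scaledTotal n s with hWW
    have : scaledUncharged n s - z t = -(W + d) := by rw [hdd, hWW]; ring
    rw [this]
    have e : (2 + 2 / c) * (d ^ 2 + c * W ^ 2) =
        2 * d ^ 2 + 2 * W ^ 2 + 2 / c * d ^ 2 + 2 * c * W ^ 2 := by field_simp; ring
    rw [e]
    have : 0 ≤ 2 / c * d ^ 2 := by positivity
    have : 0 ≤ 2 * c * W ^ 2 := by positivity
    nlinarith [sq_nonneg (W - d)]
  have h2 : ∑ s, p s * ((scaledTotal n s - scaledUncharged n s - (K - z 0)) ^ 2 +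
        c * (K - scaledTotal n s) ^ 2) ≤ (2 + c) * (msdUncharged n p (z 0) + msdTotal n p K) := by
    rw [msdUncharged, msdTotal, ← Finset.sum_add_distrib, Finset.mul_sum]
    refine Finset.sum_le_sum fun s _ => ?_
    rw [← mul_add, mul_left_comm]
    refine mul_le_mul_of_nonneg_left ?_ (hp0 s)
    set a := scaledUncharged n s - z 0 with ha
    set b := scaledTotal n s - K with hb
    have e1 : scaledTotal n s - scaledUncharged n s - (K - z 0) = b - a := by rw [ha, hb]; ring
    have e2 : (K : ℝ) - scaledTotal n s = -b := by rw [hb]; ring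
    rw [e1, e2]
    nlinarith [sq_nonneg (a + b), mul_nonneg hc0.le (sq_nonneg a)]
  have hA := msdUncharged_nonneg n hp0 (z 0)
  have hB := msdTotal_nonneg n hp0 (K : ℝ)
  calc _ ≤ _ := h1
    _ ≤ (2 + 2 / c) * (Real.exp (-(nu * t)) * ((2 + c) *
        (msdUncharged n p (z 0) + msdTotal n p K)) + C₁ / nu * (1 / n)) := by
      refine mul_le_mul_of_nonneg_left (h.trans ?_) (by positivity)
      gcongr
    _ ≤ (2 + 2 / c) * ((2 + c + C₁ / nu) * (Real.exp (-(nu * t)) *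
        (msdUncharged n p (z 0) + msdTotal n p K) + 1 / n)) := by
      refine mul_le_mul_of_nonneg_left ?_ (by positivity)
      have e1 : 0 ≤ C₁ / nu * (Real.exp (-(nu * t)) *
        (msdUncharged n p (z 0) + msdTotal n p K)) := by positivity
      have e2 : 0 ≤ (2 + c) * (1 / (n : ℝ)) := by positivity
      linarith
    _ = _ := by ring

theorem msd_bound_unsaturated (hlam : 0 < lam) (hmu : 0 < mu) (hnu : 0 < nu) (hM : 0 < M)
    (hsat : lam ≤ nu * K) : ∃ C, 0 ≤ C ∧ ∀ z, IsFluidSolution lam mu nu M K z →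
      ∀ q₀, lam / nu ≤ q₀ → q₀ ≤ K →
      ∀ (n : ℕ+) (p : State (n * K) → ℝ), (∀ s, 0 ≤ p s) → ∑ s, p s = 1 → ∀ t, 0 ≤ t →
      msdUncharged n (lawAt (scaledGenerator lam mu nu M K n) p t) (z t) ≤
        Real.exp (-(nu * t)) * (msdUncharged n p (z 0) + C * √(msdTotal n p q₀)) + C * (1 / n) +
          C * √(Real.exp (-(nu * t)) * msdTotal n p q₀ + C * (1 / n)) := by
  set C₁ := lam + mu * K + nu * K
  have hC₁ : 0 ≤ C₁ := by positivity
  set C := 2 * K + C₁ / nu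
  have hCK : 2 * K ≤ C := le_add_of_nonneg_right (by positivity)
  have hCn : C₁ / nu ≤ C := le_add_of_nonneg_left (by positivity)
  refine ⟨C, by positivity, fun z hz q₀ hq₀ hq₀K n p hp0 hp1 t ht => ?_⟩
  have hn := pnat_cast_pos n
  -- The fluid total without blocking, solving q' = λ - νq; it stays at most K because λ/ν ≤ q₀ ≤ K.
  set q : ℝ → ℝ := fun t => lam / nu + (q₀ - lam / nu) * Real.exp (-(nu * t)) with hq
  have hq0 : q 0 = q₀ := by simp [hq]
  have hqK : ∀ t, 0 ≤ t → q t ≤ K := by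
    intro t ht
    have h1 : Real.exp (-(nu * t)) ≤ 1 := Real.exp_le_one_iff.2 (by nlinarith)
    have : (q₀ - lam / nu) * Real.exp (-(nu * t)) ≤ (q₀ - lam / nu) * 1 :=
      mul_le_mul_of_nonneg_left h1 (by linarith)
    simp only [hq]
    linarith
  have hqd : ∀ t, HasDerivAt q (lam - nu * q t) t := by
    intro t
    have h1 : HasDerivAt (fun t => -(nu * t)) (-nu) t := by
      simpa [Function.comp_def, Pi.neg_def] using ((hasDerivAt_id t).const_mul nu).neg
    refine ((h1.exp.const_mul (q₀ - lam / nu)).const_add (lam / nu)).congr_deriv ?_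
    simp only [hq]
    field_simp
    ring
  have hB := lyapunov_scaled hlam hmu hnu hM hC₁ (φ := fun t x _ => (x - q t) ^ 2)
    (φ' := fun t x _ => -(2 * (x - q t) * (lam - nu * q t)))
    (fun t _ x y => by
      refine (((hqd t).hasDerivWithinAt.const_sub x).fun_pow 2).congr_deriv ?_
      push_cast
      ring)
    (fun t x y i h ht hy hyx hxK hh hi => by
      refine (drift_total_sq hlam hnu hxK (hqK t ht) hh hi).trans ?_
      have : (lam + nu * K) * h ≤ C₁ * h :=
        mul_le_mul_of_nonneg_right (by simp only [C₁]; nlinarith [mul_nonneg hmu.le K.cast_nonneg])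
          hh.le
      linarith) n hp0 hp1 ht
  have hF := lyapunov_scaled hlam hmu hnu hM hC₁
    (φ := fun t x y => (y - z t) ^ 2 + 2 * K * (x - q t))
    (φ' := fun t x y => -(2 * (y - z t) * (lam - nu * z t - mu * min (z t) M)) +
      -(2 * K * (lam - nu * q t)))
    (fun t ht x y => by
      have h := hz.hasDeriv t ht
      rw [fluidDrift, min_eq_left hsat, allocation] at h
      refine (((h.const_sub y).fun_pow 2).fun_add
        (((hqd t).hasDerivWithinAt.const_sub x).const_mul (2 * (K : ℝ)))).congr_deriv ?_
      push_cast
      ring)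
    (fun t x y i h ht hy hyx hxK hh hi =>
      drift_uncharged_unsaturated hlam hmu hnu hy hyx (hz.mem_Icc t ht).2 hxK hh hi)
    n hp0 hp1 ht
  set L := lawAt (scaledGenerator lam mu nu M K n) p t
  have hL0 : ∀ s, 0 ≤ L s := lawAt_nonneg (fun x y _ => jumpRate_nonneg (N := n * K)
    (mul_pos hn hlam).le hmu.le hnu.le (mul_pos hn hM).le x y) hp0 ht
  have hL1 : ∑ s, L s = 1 := sum_lawAt _ hp1 t
  have hsplit : ∀ (w : State (n * K) → ℝ) (a b : ℝ),
      ∑ s, w s * ((scaledUncharged n s - a) ^ 2 + 2 * K * (scaledTotal n s - b)) =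
        msdUncharged n w a + 2 * K * ∑ s, w s * (scaledTotal n s - b) := by
    intro w a b
    rw [msdUncharged, Finset.mul_sum, ← Finset.sum_add_distrib]
    exact Finset.sum_congr rfl fun s _ => by ring
  simp only [hsplit, hq0] at hF
  simp only [hq0] at hB
  -- The linear part of the Lyapunov function has no sign: it is bounded below at time t and above
  -- at time 0, each time by a root mean square.
  have h1 := (abs_le.1 (abs_sum_mul_le_sqrt hL0 hL1 fun s => scaledTotal n s - q t)).1
  have h2 := (abs_le.1 (abs_sum_mul_le_sqrt hp0 hp1 fun s => scaledTotal n s - q₀)).2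
  have hK : (0 : ℝ) ≤ K := K.cast_nonneg
  have h3 : √(∑ s, L s * (scaledTotal n s - q t) ^ 2) ≤
      √(Real.exp (-(nu * t)) * msdTotal n p q₀ + C * (1 / n)) := by
    refine Real.sqrt_le_sqrt (hB.trans ?_)
    rw [msdTotal]
    gcongr
  have h4 : 2 * K * √(∑ s, L s * (scaledTotal n s - q t) ^ 2) ≤
      C * √(Real.exp (-(nu * t)) * msdTotal n p q₀ + C * (1 / n)) := by gcongr
  have h5 : 2 * K * ∑ s, p s * (scaledTotal n s - q₀) ≤ C * √(msdTotal n p q₀) := by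
    rw [msdTotal]
    calc _ ≤ 2 * K * √(∑ s, p s * (scaledTotal n s - q₀) ^ 2) := by gcongr
      _ ≤ _ := by gcongr
  have h6 : Real.exp (-(nu * t)) * (msdUncharged n p (z 0) +
      2 * K * ∑ s, p s * (scaledTotal n s - q₀)) ≤
      Real.exp (-(nu * t)) * (msdUncharged n p (z 0) + C * √(msdTotal n p q₀)) := by gcongr
  have h7 : C₁ / nu * (1 / (n : ℝ)) ≤ C * (1 / n) := by gcongr
  have h8 := mul_le_mul_of_nonneg_left h1 (mul_nonneg two_pos.le hK)
  linarith

end Lyapunov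

/-! ### The fluid equation: zero of the drift, existence, uniqueness, attraction. -/

section Fluid

variable {lam mu nu M : ℝ} {K : ℕ}

theorem continuous_fluidDrift (lam mu nu M : ℝ) (K : ℕ) :
    Continuous (fluidDrift lam mu nu M K) := by
  unfold fluidDrift allocation
  fun_prop

theorem sub_mul_fluidDrift_sub_le (hmu : 0 < mu) (a b : ℝ) :
    (a - b) * (fluidDrift lam mu nu M K a - fluidDrift lam mu nu M K b) ≤ -nu * (a - b) ^ 2 := by
  have h := mul_nonneg hmu.le (sub_mul_min_sub_nonneg a b M)
  unfold fluidDrift allocation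
  linarith

theorem strictAnti_fluidDrift (hmu : 0 < mu) (hnu : 0 < nu) :
    StrictAnti (fluidDrift lam mu nu M K) := by
  intro a b hab
  have h := mul_lt_mul_of_pos_left hab hnu
  have h' := mul_le_mul_of_nonneg_left (min_le_min_right M hab.le) hmu.le
  unfold fluidDrift allocation
  linarith

theorem fluidDrift_pos_of_nonpos (hlam : 0 < lam) (hmu : 0 < mu) (hnu : 0 < nu) (hM : 0 < M)
    (hK : (0 : ℝ) < K) {x : ℝ} (hx : x ≤ 0) : 0 < fluidDrift lam mu nu M K x := by
  refine lt_of_lt_of_le ?_ ((strictAnti_fluidDrift hmu hnu).antitone hx)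
  simp [fluidDrift, allocation, hM.le, hlam, mul_pos hnu hK]

theorem fluidDrift_neg_of_le (hmu : 0 < mu) (hnu : 0 < nu) (hM : 0 < M)
    (hMK : M ≤ K) {x : ℝ} (hx : K ≤ x) : fluidDrift lam mu nu M K x < 0 := by
  refine lt_of_le_of_lt ((strictAnti_fluidDrift hmu hnu).antitone hx) ?_
  have h1 : min lam (nu * K) ≤ nu * K := min_le_right _ _
  have h2 : 0 < mu * M := mul_pos hmu hM
  simp only [fluidDrift, allocation, min_eq_right hMK]
  linarith

theorem exists_fluidDrift_eq_zero (hlam : 0 < lam) (hmu : 0 < mu) (hnu : 0 < nu) (hM : 0 < M)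
    (hMK : M ≤ K) : ∃ x : ℝ, 0 < x ∧ x ≤ K ∧ fluidDrift lam mu nu M K x = 0 := by
  have hK : (0 : ℝ) < K := hM.trans_le hMK
  obtain ⟨x, hx, hx0⟩ := intermediate_value_Icc' hK.le
    (continuous_fluidDrift lam mu nu M K).continuousOn
    ⟨(fluidDrift_neg_of_le hmu hnu hM hMK le_rfl).le,
      (fluidDrift_pos_of_nonpos hlam hmu hnu hM hK le_rfl).le⟩
  refine ⟨x, hx.1.lt_of_ne ?_, hx.2, hx0⟩
  rintro rfl
  exact (fluidDrift_pos_of_nonpos hlam hmu hnu hM hK le_rfl).ne' hx0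

theorem isInvariantPoint_of_fluidDrift_eq_zero {x : ℝ} (hx : x ∈ Set.Icc (0 : ℝ) K)
    (h : fluidDrift lam mu nu M K x = 0) : IsInvariantPoint lam mu nu M K x where
  continuousOn := continuousOn_const
  mem_Icc _ _ := hx
  hasDeriv t _ := by rw [h]; exact hasDerivWithinAt_const _ _ _

theorem IsInvariantPoint.fluidDrift_eq_zero {x : ℝ} (h : IsInvariantPoint lam mu nu M K x) :
    fluidDrift lam mu nu M K x = 0 :=
  (uniqueDiffOn_Ici (0 : ℝ) 0 Set.self_mem_Ici).eq_deriv _ (h.hasDeriv 0 le_rfl)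
    (hasDerivWithinAt_const _ _ _)

/-- Dissipativity of the drift makes the squared distance of two solutions decay at rate 2ν. The
domain is general because both compact intervals (gluing) and the half-line (uniqueness, attraction)
are needed. -/
theorem antitoneOn_exp_mul_sq_sub (hmu : 0 < mu) {z w : ℝ → ℝ} {D : Set ℝ} (hD : Convex ℝ D)
    (hz : ∀ t ∈ D, HasDerivWithinAt z (fluidDrift lam mu nu M K (z t)) D t)
    (hw : ∀ t ∈ D, HasDerivWithinAt w (fluidDrift lam mu nu M K (w t)) D t) :
    AntitoneOn (fun t => Real.exp (2 * nu * t) * (z t - w t) ^ 2) D := by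
  have hd : ∀ t ∈ D, HasDerivWithinAt (fun t => Real.exp (2 * nu * t) * (z t - w t) ^ 2)
      (2 * nu * Real.exp (2 * nu * t) * (z t - w t) ^ 2 + Real.exp (2 * nu * t) *
        (2 * ((z t - w t) *
          (fluidDrift lam mu nu M K (z t) - fluidDrift lam mu nu M K (w t))))) D t := by
    intro t ht
    have h1 : HasDerivAt (fun t => Real.exp (2 * nu * t)) (2 * nu * Real.exp (2 * nu * t)) t := by
      simpa [mul_comm] using ((hasDerivAt_id t).const_mul (2 * nu)).exp
    refine (h1.hasDerivWithinAt.fun_mul (((hz t ht).fun_sub (hw t ht)).fun_pow 2)).congr_deriv ?_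
    push_cast
    ring
  refine antitoneOn_of_hasDerivWithinAt_nonpos hD
    (fun t ht => (hd t ht).continuousWithinAt)
    (fun t ht => (hd t (interior_subset ht)).mono interior_subset) fun t _ => ?_
  have h := mul_le_mul_of_nonneg_left
    (sub_mul_fluidDrift_sub_le (lam := lam) (nu := nu) (M := M) (K := K) hmu (z t) (w t))
    (mul_pos two_pos (Real.exp_pos (2 * nu * t))).le
  linarith

theorem eqOn_of_fluidDrift (hmu : 0 < mu) {z w : ℝ → ℝ} {D : Set ℝ} (hD : Convex ℝ D)
    (h0 : 0 ∈ D) (hpos : ∀ t ∈ D, 0 ≤ t)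
    (hz : ∀ t ∈ D, HasDerivWithinAt z (fluidDrift lam mu nu M K (z t)) D t)
    (hw : ∀ t ∈ D, HasDerivWithinAt w (fluidDrift lam mu nu M K (w t)) D t) (h : z 0 = w 0) :
    Set.EqOn z w D := by
  intro t ht
  have h1 := antitoneOn_exp_mul_sq_sub hmu hD hz hw h0 ht (hpos t ht)
  simp only [h, sub_self] at h1
  have h2 : (z t - w t) ^ 2 ≤ 0 := by
    by_contra! h3
    have := mul_pos (Real.exp_pos (2 * nu * t)) h3
    simp at h1
    linarith
  exact sub_eq_zero.1 (pow_eq_zero_iff two_ne_zero |>.1 (le_antisymm h2 (sq_nonneg _)))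

theorem IsFluidSolution.tendsto (hmu : 0 < mu) (hnu : 0 < nu) {z : ℝ → ℝ}
    (hz : IsFluidSolution lam mu nu M K z) {x : ℝ} (hx : IsInvariantPoint lam mu nu M K x) :
    Tendsto z atTop (𝓝 x) := by
  have h := antitoneOn_exp_mul_sq_sub hmu (convex_Ici 0) hz.hasDeriv hx.hasDeriv
  have hle : ∀ t, 0 ≤ t → (z t - x) ^ 2 ≤ Real.exp (-(2 * nu * t)) * (z 0 - x) ^ 2 := by
    intro t ht
    have h1 := h Set.self_mem_Ici (Set.mem_Ici.2 ht) ht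
    rw [Real.exp_neg, inv_mul_eq_div, le_div_iff₀ (Real.exp_pos _)]
    simp only [mul_zero, Real.exp_zero, one_mul] at h1
    linarith
  have hexp : Tendsto (fun t => Real.exp (-(2 * nu * t)) * (z 0 - x) ^ 2) atTop (𝓝 0) := by
    have : Tendsto (fun t : ℝ => 2 * nu * t) atTop atTop :=
      tendsto_id.const_mul_atTop (by positivity)
    simpa using (Real.tendsto_exp_neg_atTop_nhds_zero.comp this).mul_const ((z 0 - x) ^ 2)
  have hsq : Tendsto (fun t => (z t - x) ^ 2) atTop (𝓝 0) :=
    squeeze_zero' (Eventually.of_forall fun _ => sq_nonneg _)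
      ((eventually_ge_atTop 0).mono hle) hexp
  have habs := hsq.sqrt
  simp only [Real.sqrt_sq_eq_abs, Real.sqrt_zero] at habs
  exact tendsto_sub_nhds_zero_iff.1 ((tendsto_zero_iff_abs_tendsto_zero _).2 habs)

theorem abs_fluidDrift_sub_le (hmu : 0 < mu) (hnu : 0 < nu) (a b : ℝ) :
    |fluidDrift lam mu nu M K a - fluidDrift lam mu nu M K b| ≤ (nu + mu) * |a - b| := by
  have h1 : |min a M - min b M| ≤ |a - b| := by
    simpa using abs_min_sub_min_le_max a M b M
  have e : fluidDrift lam mu nu M K a - fluidDrift lam mu nu M K b =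
      -(nu * (a - b) + mu * (min a M - min b M)) := by
    unfold fluidDrift allocation; ring
  rw [e, abs_neg]
  refine (abs_add_le _ _).trans ?_
  rw [abs_mul, abs_mul, abs_of_pos hnu, abs_of_pos hmu, add_mul]
  gcongr

/-- Picard–Lindelöf is applied to the drift precomposed with the projection onto [0, K], which is
bounded and globally Lipschitz. The drift points strictly inward at 0 and K, so the solution never
leaves [0, K] and the projection is inactive. -/
theorem exists_fluid_Icc (hlam : 0 < lam) (hmu : 0 < mu) (hnu : 0 < nu) (hM : 0 < M)
    (hMK : M ≤ K) {z₀ : ℝ} (hz₀ : z₀ ∈ Set.Icc (0 : ℝ) K) {T : ℝ} (hT : 0 ≤ T) :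
    ∃ α : ℝ → ℝ, α 0 = z₀ ∧ ∀ t ∈ Set.Icc 0 T, α t ∈ Set.Icc (0 : ℝ) K ∧
      HasDerivWithinAt α (fluidDrift lam mu nu M K (α t)) (Set.Icc 0 T) t := by
  have hK : (0 : ℝ) < K := hM.trans_le hMK
  set cl : ℝ → ℝ := fun x => max 0 (min x K) with hcl
  have hclm : ∀ x, cl x ∈ Set.Icc (0 : ℝ) K := fun x =>
    ⟨le_max_left _ _, max_le hK.le (min_le_right _ _)⟩
  have hclid : ∀ x ∈ Set.Icc (0 : ℝ) K, cl x = x := fun x hx => by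
    simp [hcl, hx.1, hx.2]
  set g : ℝ → ℝ := fun x => fluidDrift lam mu nu M K (cl x) with hg
  have hlip : LipschitzWith (Real.toNNReal (nu + mu)) g := by
    refine LipschitzWith.of_dist_le_mul fun a b => ?_
    rw [Real.dist_eq, Real.dist_eq, Real.coe_toNNReal _ (by positivity)]
    refine (abs_fluidDrift_sub_le hmu hnu _ _).trans ?_
    refine mul_le_mul_of_nonneg_left ?_ (by positivity)
    have h1 : |max 0 (min a K) - max 0 (min b K)| ≤ |min a (K : ℝ) - min b K| := by
      simpa using abs_max_sub_max_le_max 0 (min a (K : ℝ)) 0 (min b (K : ℝ))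
    have h2 : |min a (K : ℝ) - min b K| ≤ |a - b| := by
      simpa using abs_min_sub_min_le_max a (K : ℝ) b K
    exact h1.trans h2
  obtain ⟨B, hB⟩ := isCompact_Icc.exists_bound_of_continuousOn
    (continuous_fluidDrift lam mu nu M K).continuousOn (s := Set.Icc (0 : ℝ) K)
  -- With speed at most B, radius BT accommodates the whole interval at once.
  have hPL : IsPicardLindelof (fun _ => g) (tmin := 0) (tmax := T) ⟨0, le_rfl, hT⟩ z₀
      (Real.toNNReal B * Real.toNNReal T) 0 (Real.toNNReal B) (Real.toNNReal (nu + mu)) := by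
    refine ⟨fun t _ => hlip.lipschitzOnWith, fun x _ => continuousOn_const, fun t _ x _ =>
      (hB _ (hclm x)).trans (Real.le_coe_toNNReal B), ?_⟩
    simp [hT]
  obtain ⟨α, hα0, hα⟩ := hPL.exists_eq_forall_mem_Icc_hasDerivWithinAt₀
  have hcont : ContinuousOn α (Set.Icc 0 T) := fun t ht => (hα t ht).continuousWithinAt
  have hright : ∀ t ∈ Set.Ico 0 T, HasDerivWithinAt α (g (α t)) (Set.Ici t) t := fun t ht =>
    (hα t ⟨ht.1, ht.2.le⟩).mono_of_mem_nhdsWithin (Icc_mem_nhdsGE_of_mem ht)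
  have hupper : ∀ ⦃t⦄, t ∈ Set.Icc 0 T → α t ≤ K :=
    image_le_of_deriv_right_lt_deriv_boundary (B := fun _ => (K : ℝ)) (B' := fun _ => 0)
      hcont hright (by rw [hα0]; exact hz₀.2) (fun _ => hasDerivAt_const _ _) fun t _ ht => by
        simp only [hg, ht]
        rw [hclid _ ⟨hK.le, le_rfl⟩]
        exact fluidDrift_neg_of_le hmu hnu hM hMK le_rfl
  have hlower : ∀ ⦃t⦄, t ∈ Set.Icc 0 T → -α t ≤ 0 :=
    image_le_of_deriv_right_lt_deriv_boundary (f := fun t => -α t) (B := fun _ => (0 : ℝ))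
      (B' := fun _ => 0) hcont.neg (fun t ht => (hright t ht).neg)
      (by rw [hα0]; simpa using hz₀.1) (fun _ => hasDerivAt_const _ _) fun t _ ht => by
        have : α t = 0 := by simpa using ht
        simp only [hg, this]
        rw [hclid _ ⟨le_rfl, hK.le⟩]
        exact neg_lt_zero.2 (fluidDrift_pos_of_nonpos hlam hmu hnu hM hK le_rfl)
  refine ⟨α, hα0, fun t ht => ?_⟩
  have hmem : α t ∈ Set.Icc (0 : ℝ) K := ⟨by simpa using hlower ht, hupper ht⟩
  refine ⟨hmem, ?_⟩
  have := hα t ht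
  simp only [hg] at this
  rwa [hclid _ hmem] at this

theorem exists_isFluidSolution (hlam : 0 < lam) (hmu : 0 < mu) (hnu : 0 < nu) (hM : 0 < M)
    (hMK : M ≤ K) {z₀ : ℝ} (hz₀ : z₀ ∈ Set.Icc (0 : ℝ) K) :
    ∃ z, IsFluidSolution lam mu nu M K z ∧ z 0 = z₀ := by
  choose α hα0 hα using fun m : ℕ =>
    exists_fluid_Icc hlam hmu hnu hM hMK hz₀ (T := m) m.cast_nonneg
  have hagree : ∀ {m k : ℕ}, m ≤ k → Set.EqOn (α m) (α k) (Set.Icc 0 m) := by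
    intro m k hmk
    have hsub : Set.Icc (0 : ℝ) m ⊆ Set.Icc 0 k := Set.Icc_subset_Icc_right (by exact_mod_cast hmk)
    exact eqOn_of_fluidDrift hmu (convex_Icc 0 (m : ℝ)) ⟨le_rfl, m.cast_nonneg⟩
      (fun t ht => ht.1) (fun t ht => (hα m t ht).2)
      (fun t ht => (hα k t (hsub ht)).2.mono hsub) (by rw [hα0, hα0])
  set z : ℝ → ℝ := fun t => α ⌈t⌉₊ t with hz
  have hzα : ∀ m : ℕ, Set.EqOn z (α m) (Set.Icc 0 m) := fun m t ht =>
    hagree (Nat.ceil_le.2 ht.2) ⟨ht.1, Nat.le_ceil t⟩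
  have hd : ∀ t, 0 ≤ t → HasDerivWithinAt z (fluidDrift lam mu nu M K (z t)) (Set.Ici 0) t := by
    intro t ht
    -- The extra 1 puts t strictly below m, so that [0, m] is a neighbourhood of t within [0, ∞).
    set m := ⌈t⌉₊ + 1
    have htm : t < m := (Nat.le_ceil t).trans_lt (by simp [m])
    have hm : Set.Icc (0 : ℝ) m ∈ 𝓝[Set.Ici 0] t := by
      filter_upwards [self_mem_nhdsWithin, mem_nhdsWithin_of_mem_nhds (Iio_mem_nhds htm)]
        with s hs hs'
      exact ⟨hs, le_of_lt hs'⟩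
    have h1 := (hα m t ⟨ht, htm.le⟩).2.mono_of_mem_nhdsWithin hm
    rw [hzα m ⟨ht, htm.le⟩]
    exact h1.congr_of_eventuallyEq (by filter_upwards [hm] with s hs using hzα m hs)
      (hzα m ⟨ht, htm.le⟩)
  refine ⟨z, ⟨fun t ht => (hd t ht).continuousWithinAt, fun t ht => ?_, hd⟩, ?_⟩
  · exact (hα ⌈t⌉₊ t ⟨ht, Nat.le_ceil t⟩).1
  · rw [hzα 0 (by simp), hα0]

end Fluid

/-! ### The fixed-point equation with exponential variables. -/

section FixedPoint

theorem expMeasure_Ioi {r : ℝ} (hr : 0 < r) {t : ℝ} (ht : 0 ≤ t) :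
    expMeasure r (Set.Ioi t) = ENNReal.ofReal (Real.exp (-(r * t))) := by
  have := isProbabilityMeasure_expMeasure hr
  have h := cdf_expMeasure_eq hr t
  rw [if_pos ht, cdf_eq_real] at h
  rw [← ofReal_measureReal, ← Set.compl_Iic, probReal_compl_eq_one_sub measurableSet_Iic, h]
  congr 1
  ring

theorem ae_nonneg_expMeasure {r : ℝ} (hr : 0 < r) : ∀ᵐ x ∂expMeasure r, 0 ≤ x := by
  have := isProbabilityMeasure_expMeasure hr
  have h := cdf_expMeasure_eq hr 0
  rw [if_pos le_rfl, cdf_eq_real] at h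
  simp only [mul_zero, neg_zero, Real.exp_zero, sub_self] at h
  have h0 : expMeasure r (Set.Iic 0) = 0 := by
    simpa [measureReal_def, ENNReal.toReal_eq_zero_iff] using h
  refine measure_mono_null (fun x hx => ?_) h0
  exact le_of_lt (not_le.1 (show ¬ 0 ≤ x from hx))

/-- By independence the minimum exceeds t with probability e^{-(ν + μ/c)t}; the layer-cake formula
integrates this tail. -/
theorem integral_min_expMeasure {nu mu c : ℝ} (hnu : 0 < nu) (hmu : 0 < mu) (hc : 0 < c) :
    ∫ p : ℝ × ℝ, min p.1 (p.2 * c) ∂((expMeasure nu).prod (expMeasure mu)) =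
      1 / (nu + mu / c) := by
  have := isProbabilityMeasure_expMeasure hnu
  have := isProbabilityMeasure_expMeasure hmu
  have hmeas : Measurable fun p : ℝ × ℝ => min p.1 (p.2 * c) := by fun_prop
  have hnn : 0 ≤ᵐ[(expMeasure nu).prod (expMeasure mu)] fun p : ℝ × ℝ => min p.1 (p.2 * c) := by
    filter_upwards [Measure.quasiMeasurePreserving_fst.ae (ae_nonneg_expMeasure hnu),
      Measure.quasiMeasurePreserving_snd.ae (ae_nonneg_expMeasure hmu)] with p h1 h2
    exact le_min h1 (mul_nonneg h2 hc.le)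
  have hpos : 0 < nu + mu / c := by positivity
  have hset : ∀ t ∈ Set.Ioi (0 : ℝ), ((expMeasure nu).prod (expMeasure mu))
      {p : ℝ × ℝ | t < min p.1 (p.2 * c)} = ENNReal.ofReal (Real.exp (-(nu + mu / c) * t)) := by
    intro t ht
    have ht' : 0 ≤ t := le_of_lt ht
    have e : {p : ℝ × ℝ | t < min p.1 (p.2 * c)} = Set.Ioi t ×ˢ Set.Ioi (t / c) := by
      ext p
      simp [div_lt_iff₀ hc]
    rw [e, Measure.prod_prod, expMeasure_Ioi hnu ht', expMeasure_Ioi hmu (by positivity),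
      ← ENNReal.ofReal_mul (Real.exp_pos _).le, ← Real.exp_add]
    congr 2
    field_simp
    ring
  rw [integral_eq_lintegral_of_nonneg_ae hnn hmeas.aestronglyMeasurable,
    lintegral_eq_lintegral_meas_lt _ hnn hmeas.aemeasurable,
    setLIntegral_congr_fun measurableSet_Ioi hset,
    ← ofReal_integral_eq_lintegral_ofReal (integrableOn_exp_mul_Ioi (by linarith) 0)
      (Eventually.of_forall fun _ => (Real.exp_pos _).le),
    integral_exp_mul_Ioi (by linarith) 0, ENNReal.toReal_ofReal]
  · rw [mul_zero, Real.exp_zero, neg_div_neg_eq]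
  · rw [mul_zero, Real.exp_zero, neg_div_neg_eq]
    positivity

/-- Multiplying out the denominator, the point is that x / max(1, x/M) = min(x, M). -/
theorem solvesFixedPoint_iff {lam mu nu M : ℝ} {K : ℕ} (hmu : 0 < mu) (hnu : 0 < nu)
    (hM : 0 < M) {x : ℝ} (hx : 0 < x) :
    SolvesFixedPoint lam mu nu M K x ↔ fluidDrift lam mu nu M K x = 0 := by
  have hc : 0 < max 1 (x / M) := lt_max_of_lt_left one_pos
  have hpos : 0 < nu + mu / max 1 (x / M) := by positivity
  have e : x / max 1 (x / M) = min x M := by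
    rcases le_total x M with h | h
    · rw [max_eq_left ((div_le_one hM).2 h), min_eq_left h, div_one]
    · rw [max_eq_right ((one_le_div hM).2 h), min_eq_right h]
      field_simp
  rw [SolvesFixedPoint, integral_min_expMeasure hnu hmu hc, mul_one_div, eq_div_iff hpos.ne',
    fluidDrift, allocation, ← e]
  have e2 : x * (nu + mu / max 1 (x / M)) = nu * x + mu * (x / max 1 (x / M)) := by ring
  rw [e2]
  constructor <;> intro h <;> linarith

end FixedPoint

/-! ### Convergence in distribution to a constant versus mean square convergence. -/

section Distribution

theorem tendstoInDistribution_iff_integral {ι Ω' : Type*} {Ω : ι → Type*}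
    [∀ i, MeasurableSpace (Ω i)] [MeasurableSpace Ω'] {P : ∀ i, Measure (Ω i)}
    [∀ i, IsProbabilityMeasure (P i)] {P' : Measure Ω'} [IsProbabilityMeasure P']
    {X : ∀ i, Ω i → ℝ} {Z : Ω' → ℝ} {l : Filter ι} (hX : ∀ i, Measurable (X i))
    (hZ : Measurable Z) :
    TendstoInDistribution X l Z P P' ↔ ∀ f : BoundedContinuousFunction ℝ ℝ,
      Tendsto (fun i => ∫ ω, f (X i ω) ∂P i) l (𝓝 (∫ ω, f (Z ω) ∂P')) := by
  have e : ∀ i (f : BoundedContinuousFunction ℝ ℝ),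
      ∫ x, f x ∂((P i).map (X i)) = ∫ ω, f (X i ω) ∂P i := fun i f =>
    integral_map (hX i).aemeasurable f.continuous.aestronglyMeasurable
  have e' : ∀ f : BoundedContinuousFunction ℝ ℝ,
      ∫ x, f x ∂(P'.map Z) = ∫ ω, f (Z ω) ∂P' := fun f =>
    integral_map hZ.aemeasurable f.continuous.aestronglyMeasurable
  constructor
  · intro h f
    have := ProbabilityMeasure.tendsto_iff_forall_integral_tendsto.1 h.tendsto f
    simpa only [ProbabilityMeasure.coe_mk, e, e'] using this
  · intro h
    refine ⟨fun i => (hX i).aemeasurable, hZ.aemeasurable,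
      ProbabilityMeasure.tendsto_iff_forall_integral_tendsto.2 fun f => ?_⟩
    simpa only [ProbabilityMeasure.coe_mk, e, e'] using h f

/-- Chebyshev in pointwise form: continuity serves near c, and away from c the quadratic term
exceeds 2‖f‖. -/
theorem exists_abs_sub_le_add_mul_sq (f : BoundedContinuousFunction ℝ ℝ) (c : ℝ) {ε : ℝ}
    (hε : 0 < ε) : ∃ C, 0 ≤ C ∧ ∀ x, |f x - f c| ≤ ε + C * (x - c) ^ 2 := by
  obtain ⟨δ, hδ, h⟩ := Metric.continuous_iff.1 f.continuous c ε hε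
  refine ⟨2 * ‖f‖ / δ ^ 2, by positivity, fun x => ?_⟩
  by_cases hx : dist x c < δ
  · have h1 := h x hx
    rw [Real.dist_eq] at h1
    have : 0 ≤ 2 * ‖f‖ / δ ^ 2 * (x - c) ^ 2 := by positivity
    linarith
  · rw [Real.dist_eq, not_lt] at hx
    have h1 : |f x - f c| ≤ 2 * ‖f‖ := by
      simpa [Real.dist_eq] using f.dist_le_two_norm x c
    have h2 : δ ^ 2 ≤ (x - c) ^ 2 := by
      rw [← sq_abs (x - c)]
      gcongr
    have h3 : 2 * ‖f‖ ≤ 2 * ‖f‖ / δ ^ 2 * (x - c) ^ 2 := by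
      rw [div_mul_eq_mul_div, le_div_iff₀ (by positivity)]
      gcongr
    linarith

theorem tendstoInDistribution_const_of_integral_sq {ι : Type*} {Ω : ι → Type*}
    [∀ i, MeasurableSpace (Ω i)] {P : ∀ i, Measure (Ω i)}
    [∀ i, IsProbabilityMeasure (P i)] {X : ∀ i, Ω i → ℝ} {l : Filter ι}
    (hX : ∀ i, Measurable (X i)) {c : ℝ} (hint : ∀ i, Integrable (fun ω => (X i ω - c) ^ 2) (P i))
    (h : Tendsto (fun i => ∫ ω, (X i ω - c) ^ 2 ∂P i) l (𝓝 0)) :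
    TendstoInDistribution X l (fun _ : Unit => c) P (Measure.dirac ()) := by
  rw [tendstoInDistribution_iff_integral hX measurable_const]
  intro f
  simp only [integral_const, probReal_univ, one_smul]
  rw [Metric.tendsto_nhds]
  intro ε hε
  obtain ⟨C, hC, hf⟩ := exists_abs_sub_le_add_mul_sq f c (half_pos hε)
  have h1 : ∀ᶠ i in l, C * ∫ ω, (X i ω - c) ^ 2 ∂P i < ε / 2 := by
    have := h.const_mul C
    rw [mul_zero] at this
    exact this.eventually_lt_const (half_pos hε)
  filter_upwards [h1] with i hi
  have hfi : Integrable (fun ω => f (X i ω)) (P i) :=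
    Integrable.of_bound (f.continuous.measurable.comp (hX i)).aestronglyMeasurable ‖f‖
      (Eventually.of_forall fun ω => f.norm_coe_le_norm _)
  have e : ∫ ω, f (X i ω) ∂P i - f c = ∫ ω, (f (X i ω) - f c) ∂P i := by
    rw [integral_sub hfi (integrable_const _)]
    simp
  rw [Real.dist_eq, e]
  calc |∫ ω, (f (X i ω) - f c) ∂P i| ≤ ∫ ω, |f (X i ω) - f c| ∂P i := abs_integral_le_integral_abs
    _ ≤ ∫ ω, (ε / 2 + C * (X i ω - c) ^ 2) ∂P i :=
        integral_mono (hfi.sub (integrable_const _)).abs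
          ((integrable_const _).add ((hint i).const_mul C)) fun ω => hf (X i ω)
    _ = ε / 2 + C * ∫ ω, (X i ω - c) ^ 2 ∂P i := by
        rw [integral_add (integrable_const _) ((hint i).const_mul C), integral_const_mul]
        simp
    _ < ε := by linarith

theorem tendsto_integral_sq_of_tendstoInDistribution_const {ι : Type*} {Ω : ι → Type*}
    [∀ i, MeasurableSpace (Ω i)] {P : ∀ i, Measure (Ω i)}
    [∀ i, IsProbabilityMeasure (P i)] {X : ∀ i, Ω i → ℝ} {l : Filter ι}
    (hX : ∀ i, Measurable (X i)) {c B : ℝ} (hB : ∀ i ω, (X i ω - c) ^ 2 ≤ B)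
    (hB0 : 0 ≤ B)
    (h : TendstoInDistribution X l (fun _ : Unit => c) P (Measure.dirac ())) :
    Tendsto (fun i => ∫ ω, (X i ω - c) ^ 2 ∂P i) l (𝓝 0) := by
  rw [tendstoInDistribution_iff_integral hX measurable_const] at h
  -- The square is capped at `B` to be a bounded test function; by `hB` the cap is never active on
  -- the range of `X`.
  have := h (BoundedContinuousFunction.ofNormedAddCommGroup (fun x => min ((x - c) ^ 2) B)
    (by fun_prop) B fun x => by
      rw [Real.norm_of_nonneg (le_min (sq_nonneg _) hB0)]
      exact min_le_right _ _)
  simpa [hB0, min_eq_left (hB _ _)] using this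

theorem integral_comp_eq_sum {S Ω : Type*} [Fintype S] [MeasurableSpace S]
    [MeasurableSingletonClass S] [MeasurableSpace Ω] (P : Measure Ω) [IsProbabilityMeasure P]
    {Y : Ω → S} (hY : Measurable Y) (f : S → ℝ) :
    ∫ ω, f (Y ω) ∂P = ∑ s, P.real {ω | Y ω = s} * f s := by
  have hm := Measure.isProbabilityMeasure_map (μ := P) hY.aemeasurable
  rw [← integral_map hY.aemeasurable (measurable_of_finite f).aestronglyMeasurable,
    integral_fintype .of_finite]
  refine Finset.sum_congr rfl fun s _ => ?_
  rw [map_measureReal_apply hY (measurableSet_singleton s), smul_eq_mul]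
  rfl

theorem sum_real_fiber_eq_one {S Ω : Type*} [Fintype S] [MeasurableSpace S]
    [MeasurableSingletonClass S] [MeasurableSpace Ω] (P : Measure Ω) [IsProbabilityMeasure P]
    {Y : Ω → S} (hY : Measurable Y) : ∑ s, P.real {ω | Y ω = s} = 1 := by
  simpa using (integral_comp_eq_sum P hY fun _ => 1).symm

theorem sum_real_singleton {S : Type*} [Fintype S] [MeasurableSpace S]
    [MeasurableSingletonClass S] (π : Measure S) [IsProbabilityMeasure π] :
    ∑ x, π.real {x} = 1 := by
  simp

end Distribution

/-! ### One-time laws of Markov processes and their stationary laws. -/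

theorem IsStationaryLaw.lawAt_eq {S : Type*} [Fintype S] [DecidableEq S] [MeasurableSpace S]
    {G : Matrix S S ℝ} {π : Measure S} (h : IsStationaryLaw G π)
    {t : ℝ} (ht : 0 ≤ t) : lawAt G (fun x => π.real {x}) t = fun x => π.real {x} :=
  funext fun y => h.2 ⟨t, ht⟩ y

section MarkovProcess

variable {S : Type*} [Fintype S] [DecidableEq S] [MeasurableSpace S]
  [MeasurableSingletonClass S]

theorem IsMarkovProcess.real_eq_lawAt {Ω : Type*} [MeasurableSpace Ω] {G : Matrix S S ℝ}
    {P : Measure Ω} [IsProbabilityMeasure P] {X : ℝ≥0 → Ω → S} (h : IsMarkovProcess G P X)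
    (t : ℝ≥0) (y : S) : P.real {ω | X t ω = y} = lawAt G (fun x => P.real {ω | X 0 ω = x}) t y := by
  have h2 : ∀ x, P.real {ω | X 0 ω = x ∧ X t ω = y} =
      P.real {ω | X 0 ω = x} * transitionMatrix G t x y := by
    intro x
    -- The joint law at times 0 and t; summing over the initial state then gives the law at t.
    have := h.finite_dim 1 ![0, t] (by
      rw [Fin.monotone_iff_le_succ]
      intro i
      fin_cases i
      simp) ![x, y]
    simpa [Fin.forall_fin_two] using this
  have hm : ∀ (s : ℝ≥0) (x : S), MeasurableSet {ω | X s ω = x} := fun s x =>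
    h.measurable s (measurableSet_singleton x)
  unfold lawAt
  simp_rw [← h2]
  rw [← measureReal_biUnion_finset]
  · congr 1
    ext ω
    simp
  · intro a _ b _ hab
    refine Set.disjoint_left.2 fun ω h1 h3 => hab ?_
    exact h1.1.symm.trans h3.1
  · exact fun x _ => (hm 0 x).inter (hm t y)

/-- p - π has total mass zero, so the semigroup contracts it to zero, while π itself does not move.
-/
theorem tendsto_lawAt_of_isStationaryLaw {r : S → S → ℝ} (hr : ∀ x y, x ≠ y → 0 ≤ r x y) {x₀ : S}
    (hx₀ : ∀ x, Relation.ReflTransGen (fun a b => a ≠ b ∧ 0 < r a b) x x₀) {p : S → ℝ}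
    (hp1 : ∑ x, p x = 1) {π : Measure S} (hπ : IsStationaryLaw (generatorOfRates r) π) (s : S) :
    Tendsto (fun t : ℝ≥0 => lawAt (generatorOfRates r) p t s) atTop (𝓝 (π.real {s})) := by
  have := hπ.1
  have h := tendsto_sum_mul_transitionMatrix_zero hr hx₀ (u := fun x => p x - π.real {x})
    (by rw [Finset.sum_sub_distrib, hp1, sum_real_singleton, sub_self])
  rw [← tendsto_sub_nhds_zero_iff]
  refine squeeze_zero_norm (fun t => ?_) h
  have e : lawAt (generatorOfRates r) p t s - π.real {s} =
      ∑ x, (p x - π.real {x}) * transitionMatrix (generatorOfRates r) t x s := by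
    simp_rw [sub_mul, Finset.sum_sub_distrib, hπ.2 t s]
    rfl
  rw [e, Real.norm_eq_abs]
  exact Finset.single_le_sum (f := fun y => |∑ x, (p x - π.real {x}) *
    transitionMatrix (generatorOfRates r) t x y|) (fun _ _ => abs_nonneg _) (Finset.mem_univ s)

theorem existsUnique_isStationaryLaw {r : S → S → ℝ} (hr : ∀ x y, x ≠ y → 0 ≤ r x y) {x₀ : S}
    (hx₀ : ∀ x, Relation.ReflTransGen (fun a b => a ≠ b ∧ 0 < r a b) x x₀) :
    ∃! π : Measure S, IsStationaryLaw (generatorOfRates r) π := by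
  have : Nonempty S := ⟨x₀⟩
  obtain ⟨v, hv0, hv1, hv⟩ := exists_invariant_probability hr
  set π : Measure S := ∑ x, ENNReal.ofReal (v x) • Measure.dirac x with hπ
  have hπs : ∀ y, π {y} = ENNReal.ofReal (v y) := by
    intro y
    simp only [hπ, Measure.coe_finsetSum, Finset.sum_apply, Measure.smul_apply, smul_eq_mul]
    rw [Finset.sum_eq_single y]
    · simp
    · intro x _ hxy
      simp [hxy]
    · simp
  have hπr : ∀ y, π.real {y} = v y := fun y => by
    rw [measureReal_def, hπs, ENNReal.toReal_ofReal (hv0 y)]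
  have hprob : IsProbabilityMeasure π := ⟨by
    simp only [hπ, Measure.coe_finsetSum, Finset.sum_apply, Measure.smul_apply, smul_eq_mul,
      measure_univ, mul_one]
    rw [← ENNReal.ofReal_sum_of_nonneg fun x _ => hv0 x, hv1, ENNReal.ofReal_one]⟩
  refine ⟨π, ⟨hprob, fun t y => by simp_rw [hπr]; exact hv t y⟩, fun ρ hρ => ?_⟩
  have := hρ.1
  refine Measure.ext_of_singleton fun s => ?_
  -- Uniqueness: the chain started from π converges to ρ, yet its law is constantly π.
  have h := tendsto_lawAt_of_isStationaryLaw hr hx₀ (sum_real_singleton π) hρ s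
  have h2 : Tendsto (fun t : ℝ≥0 => lawAt (generatorOfRates r) (fun x => π.real {x}) t s)
      atTop (𝓝 (π.real {s})) := by
    refine tendsto_const_nhds.congr fun t => ?_
    simp only [lawAt, hπr]
    exact (hv t s).symm
  have h3 := tendsto_nhds_unique h h2
  rwa [measureReal_eq_measureReal_iff] at h3

end MarkovProcess

/-! ### The limits n → ∞, at fixed time and in stationarity. -/

section Limits

variable {lam mu nu M : ℝ} {K : ℕ}

/-- Common form of the two regimes, with q₀ = K in the unsaturated one, to match Q^n(0)/n → K. -/
theorem exists_msd_bound (hlam : 0 < lam) (hmu : 0 < mu) (hnu : 0 < nu) (hM : 0 < M) :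
    ∃ C, ∀ z, IsFluidSolution lam mu nu M K z →
      ∀ (n : ℕ+) (p : State (n * K) → ℝ), (∀ s, 0 ≤ p s) → ∑ s, p s = 1 → ∀ t, 0 ≤ t → ∀ δ,
      δ = Real.exp (-(nu * t)) * (msdUncharged n p (z 0) + √(msdTotal n p K) + msdTotal n p K) +
        1 / n →
      msdUncharged n (lawAt (scaledGenerator lam mu nu M K n) p t) (z t) ≤ C * (δ + √δ) := by
  rcases le_total (nu * K) lam with hsat | hsat
  · obtain ⟨C, hC, h⟩ := msd_bound_saturated hlam hmu hnu hM hsat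
    refine ⟨C, fun z hz n p hp0 hp1 t ht δ hδ => (h z hz n p hp0 hp1 t ht).trans ?_⟩
    refine mul_le_mul_of_nonneg_left ?_ hC
    have h1 := Real.sqrt_nonneg δ
    have h2 : 0 ≤ Real.exp (-(nu * t)) * √(msdTotal n p K) := by positivity
    linarith
  · obtain ⟨C, hC, h⟩ := msd_bound_unsaturated hlam hmu hnu hM hsat
    refine ⟨(1 + C) * (1 + C), fun z hz n p hp0 hp1 t ht δ hδ =>
      (h z hz K ((div_le_iff₀' hnu).2 hsat) le_rfl n p hp0 hp1 t ht).trans ?_⟩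
    have hn := pnat_cast_pos n
    have hA := msdUncharged_nonneg n hp0 (z 0)
    have hB := msdTotal_nonneg n hp0 (K : ℝ)
    set e := Real.exp (-(nu * t))
    have he : 0 ≤ e := (Real.exp_pos _).le
    have heA := mul_nonneg he hA
    have heB := mul_nonneg he hB
    have heS := mul_nonneg he (Real.sqrt_nonneg (msdTotal n p K))
    have hn' : 0 ≤ 1 / (n : ℝ) := by positivity
    have hδ0 : 0 ≤ δ := by rw [hδ]; positivity
    have h1 : e * (msdUncharged n p (z 0) + C * √(msdTotal n p K)) + C * (1 / n) ≤
        (1 + C) * δ := by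
      rw [hδ]
      linarith [mul_nonneg hC heA, mul_nonneg hC heB]
    -- The square is deliberate: it leaves the square root as 1 + C.
    have h2 : e * msdTotal n p K + C * (1 / n) ≤ (1 + C) ^ 2 * δ := by
      have : e * msdTotal n p K + C * (1 / n) ≤ (1 + C) * δ := by
        rw [hδ]
        linarith [mul_nonneg hC heA, mul_nonneg hC heB, mul_nonneg hC heS]
      refine this.trans ?_
      have h3 : (1 + C) ≤ (1 + C) ^ 2 := by nlinarith
      gcongr
    have h3 : √(e * msdTotal n p K + C * (1 / n)) ≤ (1 + C) * √δ := by
      refine (Real.sqrt_le_sqrt h2).trans_eq ?_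
      rw [Real.sqrt_mul (by positivity), Real.sqrt_sq (by positivity)]
    have h4 := mul_le_mul_of_nonneg_left h3 hC
    have h5 : 0 ≤ (1 + C) * √δ := by positivity
    have h6 : 0 ≤ (1 + C) * δ := by positivity
    have h7 := mul_nonneg hC h6
    linarith

theorem tendsto_one_div_pnat : Tendsto (fun n : ℕ+ => 1 / (n : ℝ)) atTop (𝓝 0) :=
  tendsto_one_div_atTop_nhds_zero_nat.comp tendsto_PNat_val_atTop_atTop

theorem tendsto_mul_add_sqrt_zero {ι : Type*} {l : Filter ι} {δ : ι → ℝ} (C : ℝ)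
    (h : Tendsto δ l (𝓝 0)) : Tendsto (fun i => C * (δ i + √(δ i))) l (𝓝 0) := by
  simpa using (h.add h.sqrt).const_mul C

/-- Under the stationary law and along a constant solution the left side of the bound is independent
of t, so t → ∞ removes the initial error. Nothing has to be known about Q^n(∞). -/
theorem exists_msd_stationary_bound (hlam : 0 < lam) (hmu : 0 < mu) (hnu : 0 < nu) (hM : 0 < M) :
    ∃ C, ∀ x, IsInvariantPoint lam mu nu M K x → ∀ (n : ℕ+) (π : Measure (State (n * K))),
      IsStationaryLaw (scaledGenerator lam mu nu M K n) π →
      msdUncharged n (fun s => π.real {s}) x ≤ C * (1 / n + √(1 / n)) := by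
  obtain ⟨C, hC⟩ := exists_msd_bound (K := K) hlam hmu hnu hM
  refine ⟨C, fun x hx n π hπ => ?_⟩
  have := hπ.1
  set p : State (n * K) → ℝ := fun s => π.real {s} with hp
  have hle : ∀ t : ℝ, 0 ≤ t → msdUncharged n p x ≤
      C * ((Real.exp (-(nu * t)) * (msdUncharged n p x + √(msdTotal n p K) + msdTotal n p K) +
        1 / n) + √(Real.exp (-(nu * t)) * (msdUncharged n p x + √(msdTotal n p K) +
        msdTotal n p K) + 1 / n)) := by
    intro t ht
    have h := hC (fun _ => x) hx n p (fun s => measureReal_nonneg) (sum_real_singleton π) t ht _ rfl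
    rwa [hp, hπ.lawAt_eq ht] at h
  have hexp : Tendsto (fun t : ℝ => Real.exp (-(nu * t)) *
      (msdUncharged n p x + √(msdTotal n p K) + msdTotal n p K) + 1 / (n : ℝ)) atTop
      (𝓝 (1 / n)) := by
    have : Tendsto (fun t : ℝ => nu * t) atTop atTop := tendsto_id.const_mul_atTop hnu
    simpa using ((Real.tendsto_exp_neg_atTop_nhds_zero.comp this).mul_const _).add_const _
  exact ge_of_tendsto ((hexp.add hexp.sqrt).const_mul C) ((eventually_ge_atTop 0).mono hle)

theorem scaledUncharged_mem_Icc (n : ℕ+) (s : State (n * K)) :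
    scaledUncharged n s ∈ Set.Icc (0 : ℝ) K :=
  ⟨scaledUncharged_nonneg n s, (scaledUncharged_le_scaledTotal n s).trans (scaledTotal_le n s)⟩

theorem sq_sub_le_of_mem_Icc {a b k : ℝ} (ha : a ∈ Set.Icc 0 k) (hb : b ∈ Set.Icc 0 k) :
    (a - b) ^ 2 ≤ k ^ 2 :=
  sq_le_sq' (by linarith [ha.1, hb.2]) (by linarith [ha.2, hb.1])

theorem map_real_singleton {S Ω : Type*} [MeasurableSpace S] [MeasurableSingletonClass S]
    [MeasurableSpace Ω] {P : Measure Ω} {Y : Ω → S} (hY : Measurable Y) (s : S) :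
    (P.map Y).real {s} = P.real {ω | Y ω = s} :=
  map_measureReal_apply hY (measurableSet_singleton s)

theorem isTightMeasureSet_scaledUncharged {Ω : ℕ+ → Type*} [∀ n, MeasurableSpace (Ω n)]
    {P : ∀ n, Measure (Ω n)} {Y : ∀ n, Ω n → State (n * K)}
    (hY : ∀ n, Measurable (Y n)) : IsTightMeasureSet
      (Set.range fun n => (P n).map (fun ω => scaledUncharged n (Y n ω))) := by
  rw [isTightMeasureSet_iff_exists_isCompact_measure_compl_le]
  refine fun ε _ => ⟨Set.Icc 0 K, isCompact_Icc, ?_⟩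
  rintro _ ⟨n, rfl⟩
  have hm : Measurable fun ω => scaledUncharged n (Y n ω) :=
    (measurable_of_finite (scaledUncharged n)).comp (hY n)
  change (P n).map (fun ω => scaledUncharged n (Y n ω)) _ ≤ ε
  rw [Measure.map_apply hm measurableSet_Icc.compl]
  have : (fun ω => scaledUncharged n (Y n ω)) ⁻¹' (Set.Icc (0 : ℝ) K)ᶜ = ∅ := by
    ext ω
    simpa using scaledUncharged_mem_Icc n (Y n ω)
  rw [this, measure_empty]
  exact zero_le

variable {Ω : ℕ+ → Type*} [∀ n, MeasurableSpace (Ω n)] {P : ∀ n, Measure (Ω n)}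
  [∀ n, IsProbabilityMeasure (P n)]

theorem tendstoInDistribution_of_msdUncharged {Y : ∀ n, Ω n → State (n * K)}
    (hY : ∀ n, Measurable (Y n)) {x : ℝ} (hx : x ∈ Set.Icc (0 : ℝ) K)
    (h : Tendsto (fun n => msdUncharged n (fun s => (P n).real {ω | Y n ω = s}) x) atTop (𝓝 0)) :
    TendstoInDistribution (fun n ω => scaledUncharged n (Y n ω)) atTop
      (fun _ : Unit => x) P (Measure.dirac ()) := by
  have hm : ∀ n, Measurable fun ω => scaledUncharged n (Y n ω) := fun n =>
    (measurable_of_finite (scaledUncharged n)).comp (hY n)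
  refine tendstoInDistribution_const_of_integral_sq hm (fun n => ?_) ?_
  · refine Integrable.of_bound ((hm n).sub_const x |>.pow_const 2).aestronglyMeasurable ((K : ℝ) ^ 2)
      (Eventually.of_forall fun ω => ?_)
    rw [Real.norm_of_nonneg (sq_nonneg _)]
    exact sq_sub_le_of_mem_Icc (scaledUncharged_mem_Icc n _) hx
  · refine h.congr fun n => ?_
    exact (integral_comp_eq_sum (P n) (hY n) fun s => (scaledUncharged n s - x) ^ 2).symm

theorem tendsto_msdUncharged_of_tendstoInDistribution {Y : ∀ n, Ω n → State (n * K)}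
    (hY : ∀ n, Measurable (Y n)) {x : ℝ} (hx : x ∈ Set.Icc (0 : ℝ) K)
    (h : TendstoInDistribution (fun n ω => scaledUncharged n (Y n ω)) atTop
      (fun _ : Unit => x) P (Measure.dirac ())) :
    Tendsto (fun n => msdUncharged n (fun s => (P n).real {ω | Y n ω = s}) x) atTop (𝓝 0) := by
  have := tendsto_integral_sq_of_tendstoInDistribution_const
    (fun n => (measurable_of_finite (scaledUncharged n)).comp (hY n)) (B := (K : ℝ) ^ 2)
    (fun n ω => sq_sub_le_of_mem_Icc (scaledUncharged_mem_Icc n (Y n ω)) hx) (by positivity) h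
  exact this.congr fun n =>
    integral_comp_eq_sum (P n) (hY n) fun s => (scaledUncharged n s - x) ^ 2

theorem tendsto_msdTotal_of_tendstoInDistribution {Y : ∀ n, Ω n → State (n * K)}
    (hY : ∀ n, Measurable (Y n))
    (h : TendstoInDistribution (fun n ω => scaledTotal n (Y n ω)) atTop
      (fun _ : Unit => (K : ℝ)) P (Measure.dirac ())) :
    Tendsto (fun n => msdTotal n (fun s => (P n).real {ω | Y n ω = s}) K) atTop (𝓝 0) := by
  have := tendsto_integral_sq_of_tendstoInDistribution_const
    (fun n => (measurable_of_finite (scaledTotal n)).comp (hY n)) (B := (K : ℝ) ^ 2)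
    (fun n ω => sq_sub_le_of_mem_Icc
      ⟨(scaledUncharged_nonneg n _).trans (scaledUncharged_le_scaledTotal n (Y n ω)),
        scaledTotal_le n (Y n ω)⟩ ⟨K.cast_nonneg, le_rfl⟩) (by positivity) h
  exact this.congr fun n =>
    integral_comp_eq_sum (P n) (hY n) fun s => (scaledTotal n s - K) ^ 2

theorem tendstoInDistribution_stationary (hlam : 0 < lam) (hmu : 0 < mu) (hnu : 0 < nu)
    (hM : 0 < M) {x : ℝ} (hx : IsInvariantPoint lam mu nu M K x) {Y : ∀ n, Ω n → State (n * K)}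
    (hY : ∀ n, Measurable (Y n))
    (hst : ∀ n, IsStationaryLaw (scaledGenerator lam mu nu M K n) ((P n).map (Y n))) :
    TendstoInDistribution (fun n ω => scaledUncharged n (Y n ω)) atTop
      (fun _ : Unit => x) P (Measure.dirac ()) := by
  obtain ⟨C, hC⟩ := exists_msd_stationary_bound (K := K) hlam hmu hnu hM
  refine tendstoInDistribution_of_msdUncharged hY (hx.mem_Icc 0 le_rfl) ?_
  refine squeeze_zero (fun n => msdUncharged_nonneg n (fun _ => measureReal_nonneg) x)
    (fun n => ?_) (tendsto_mul_add_sqrt_zero C tendsto_one_div_pnat)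
  have := hC x hx n _ (hst n)
  simpa only [map_real_singleton (hY n)] using this

theorem tendstoInDistribution_fluid (hlam : 0 < lam) (hmu : 0 < mu) (hnu : 0 < nu)
    (hM : 0 < M) {z : ℝ → ℝ} (hz : IsFluidSolution lam mu nu M K z)
    {X : ∀ n, ℝ≥0 → Ω n → State (n * K)}
    (hX : ∀ n, IsMarkovProcess (scaledGenerator lam mu nu M K n) (P n) (X n))
    (hZ : TendstoInDistribution (fun n ω => scaledUncharged n (X n 0 ω)) atTop
      (fun _ : Unit => z 0) P (Measure.dirac ()))
    (hQ : TendstoInDistribution (fun n ω => scaledTotal n (X n 0 ω)) atTop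
      (fun _ : Unit => (K : ℝ)) P (Measure.dirac ())) (t : ℝ≥0) :
    TendstoInDistribution (fun n ω => scaledUncharged n (X n t ω)) atTop
      (fun _ : Unit => z t) P (Measure.dirac ()) := by
  have hm : ∀ s n, Measurable (X n s) := fun s n => (hX n).measurable s
  obtain ⟨C, hC⟩ := exists_msd_bound (K := K) hlam hmu hnu hM
  have hA := tendsto_msdUncharged_of_tendstoInDistribution (hm 0) (hz.mem_Icc 0 le_rfl) hZ
  have hB := tendsto_msdTotal_of_tendstoInDistribution (hm 0) hQ
  refine tendstoInDistribution_of_msdUncharged (hm t) (hz.mem_Icc t t.2) ?_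
  have hδ := (((hA.add hB.sqrt).add hB).const_mul (Real.exp (-(nu * t)))).add tendsto_one_div_pnat
  simp only [Real.sqrt_zero, add_zero, mul_zero] at hδ
  refine squeeze_zero (fun n => msdUncharged_nonneg n (fun _ => measureReal_nonneg) (z t))
    (fun n => ?_) (tendsto_mul_add_sqrt_zero C hδ)
  have e : (fun s => (P n).real {ω | X n t ω = s}) = lawAt (scaledGenerator lam mu nu M K n)
      (fun s => (P n).real {ω | X n 0 ω = s}) t := funext fun s => (hX n).real_eq_lawAt t s
  rw [e]
  exact hC z hz n _ (fun _ => measureReal_nonneg) (sum_real_fiber_eq_one (P n) (hm 0 n)) t t.2 _ rfl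

end Limits

/-! ### The limit t → ∞ for fixed n. -/

theorem tendstoInDistribution_comp_of_tendsto_real {S ι Ω' : Type*} [Fintype S] [MeasurableSpace S]
    [MeasurableSingletonClass S] {Ω : ι → Type*} [∀ i, MeasurableSpace (Ω i)] [MeasurableSpace Ω']
    {P : ∀ i, Measure (Ω i)} [∀ i, IsProbabilityMeasure (P i)] {P' : Measure Ω'}
    [IsProbabilityMeasure P'] {l : Filter ι} {X : ∀ i, Ω i → S} {Y : Ω' → S}
    (hX : ∀ i, Measurable (X i)) (hY : Measurable Y) (g : S → ℝ)
    (h : ∀ s, Tendsto (fun i => (P i).real {ω | X i ω = s}) l (𝓝 (P'.real {ω | Y ω = s}))) :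
    TendstoInDistribution (fun i ω => g (X i ω)) l (fun ω => g (Y ω)) P P' := by
  refine (tendstoInDistribution_iff_integral (fun i => (measurable_of_finite g).comp (hX i))
    ((measurable_of_finite g).comp hY)).2 fun f => ?_
  simp only [Function.comp_apply]
  rw [integral_comp_eq_sum P' hY fun s => f (g s)]
  simp_rw [fun i => integral_comp_eq_sum (P i) (hX i) fun s => f (g s)]
  exact tendsto_finsetSum _ fun s _ => (h s).mul_const _

theorem IsMarkovProcess.tendsto_real {S Ω : Type*} [Fintype S] [DecidableEq S] [MeasurableSpace S]
    [MeasurableSingletonClass S] [MeasurableSpace Ω] {r : S → S → ℝ}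
    (hr : ∀ x y, x ≠ y → 0 ≤ r x y) {x₀ : S}
    (hx₀ : ∀ x, Relation.ReflTransGen (fun a b => a ≠ b ∧ 0 < r a b) x x₀) {P : Measure Ω}
    [IsProbabilityMeasure P] {X : ℝ≥0 → Ω → S} (hX : IsMarkovProcess (generatorOfRates r) P X)
    {π : Measure S} (hπ : IsStationaryLaw (generatorOfRates r) π) (s : S) :
    Tendsto (fun t => P.real {ω | X t ω = s}) atTop (𝓝 (π.real {s})) := by
  exact (tendsto_lawAt_of_isStationaryLaw hr hx₀ (sum_real_fiber_eq_one P (hX.measurable 0)) hπ s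
    ).congr fun t => (hX.real_eq_lawAt t s).symm

end EVCharging

/-! ### The main theorem. -/

theorem mainTheorem6 (lam mu nu M : ℝ) (K : ℕ) (hlam : 0 < lam) (hmu : 0 < mu) (hnu : 0 < nu)
    (hM : 0 < M) (hMK : M ≤ K) :
    ∃ zstar : ℝ,
      -- the point z*: the unique invariant point of the fluid model, and the unique positive
      -- solution of the fixed-point equation
      (∀ x : ℝ, IsInvariantPoint lam mu nu M K x ↔ x = zstar) ∧
      (∀ x : ℝ, (0 < x ∧ SolvesFixedPoint lam mu nu M K x) ↔ x = zstar) ∧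
      -- every system has a unique stationary law, and it is the limit law as t → ∞
      (∀ n : ℕ+, ∃! π : Measure (State (n * K)),
        IsStationaryLaw (scaledGenerator lam mu nu M K n) π) ∧
      (∀ (n : ℕ+) (Ω : Type*) [MeasurableSpace Ω] (P : Measure Ω) [IsProbabilityMeasure P]
        (X : ℝ≥0 → Ω → State (n * K)) (π : Measure (State (n * K))),
        IsMarkovProcess (scaledGenerator lam mu nu M K n) P X →
        IsStationaryLaw (scaledGenerator lam mu nu M K n) π →
        ∀ s, Tendsto (fun t => P.real {ω | X t ω = s}) atTop (𝓝 (π.real {s}))) ∧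
      -- for stationary random vectors, Z^n(∞) / n is tight and converges in distribution to z*
      (∀ (Ω : ℕ+ → Type*) [∀ n, MeasurableSpace (Ω n)] (P : ∀ n, Measure (Ω n))
        [∀ n, IsProbabilityMeasure (P n)] (Y : ∀ n, Ω n → State (n * K)),
        (∀ n, Measurable (Y n)) →
        (∀ n, IsStationaryLaw (scaledGenerator lam mu nu M K n) ((P n).map (Y n))) →
        IsTightMeasureSet
          (Set.range fun n => (P n).map (fun ω => scaledUncharged n (Y n ω))) ∧
        TendstoInDistribution (fun n ω => scaledUncharged n (Y n ω)) atTop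
          (fun _ : Unit => zstar) P (Measure.dirac ())) ∧
      -- interchange: t → ∞ followed by n → ∞ gives Z^n(∞) / n, then z*;
      -- n → ∞ followed by t → ∞ gives the fluid-model solution z(t), then z*
      (∀ z0 ∈ Set.Icc (0 : ℝ) K, ∃ z : ℝ → ℝ,
        IsFluidSolution lam mu nu M K z ∧ z 0 = z0 ∧
        (∀ w : ℝ → ℝ, IsFluidSolution lam mu nu M K w → w 0 = z0 → Set.EqOn w z (Set.Ici 0)) ∧
        Tendsto z atTop (𝓝 zstar) ∧
        ∀ (Ω : ℕ+ → Type*) [∀ n, MeasurableSpace (Ω n)] (P : ∀ n, Measure (Ω n))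
          [∀ n, IsProbabilityMeasure (P n)] (X : ∀ n, ℝ≥0 → Ω n → State (n * K))
          (Ω' : ℕ+ → Type*) [∀ n, MeasurableSpace (Ω' n)] (P' : ∀ n, Measure (Ω' n))
          [∀ n, IsProbabilityMeasure (P' n)] (Y : ∀ n, Ω' n → State (n * K)),
          (∀ n, IsMarkovProcess (scaledGenerator lam mu nu M K n) (P n) (X n)) →
          TendstoInDistribution (fun n ω => scaledUncharged n (X n 0 ω)) atTop
            (fun _ : Unit => z0) P (Measure.dirac ()) →
          TendstoInDistribution (fun n ω => scaledTotal n (X n 0 ω)) atTop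
            (fun _ : Unit => (K : ℝ)) P (Measure.dirac ()) →
          (∀ n, Measurable (Y n)) →
          (∀ n, IsStationaryLaw (scaledGenerator lam mu nu M K n) ((P' n).map (Y n))) →
          (∀ n, TendstoInDistribution (fun t ω => scaledUncharged n (X n t ω)) atTop
            (fun ω => scaledUncharged n (Y n ω)) (fun _ => P n) (P' n)) ∧
          TendstoInDistribution (fun n ω => scaledUncharged n (Y n ω)) atTop
            (fun _ : Unit => zstar) P' (Measure.dirac ()) ∧
          (∀ t : ℝ≥0, TendstoInDistribution (fun n ω => scaledUncharged n (X n t ω)) atTop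
            (fun _ : Unit => z t) P (Measure.dirac ()))) := by
  have hK : (0 : ℝ) < K := hM.trans_le hMK
  have hr : ∀ (n : ℕ+) (x y : State (n * K)), x ≠ y → 0 ≤ jumpRate (n * lam) mu nu (n * M) x y :=
    fun n x y _ => jumpRate_nonneg (mul_pos (pnat_cast_pos n) hlam).le hmu.le hnu.le
      (mul_pos (pnat_cast_pos n) hM).le x y
  have hreach : ∀ n : ℕ+, ∃ x₀ : State (n * K), ∀ x, Relation.ReflTransGen
      (fun a b => a ≠ b ∧ 0 < jumpRate (n * lam) mu nu (n * M) a b) x x₀ := fun n => by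
    -- The empty station serves as the Doeblin state.
    obtain ⟨s₀, hs₀, -⟩ := exists_state (N := n * K) (le_refl 0) (Nat.zero_le _)
    exact ⟨s₀, reflTransGen_jumpRate hnu hs₀⟩
  obtain ⟨zstar, hpos, hle, hzero⟩ := exists_fluidDrift_eq_zero hlam hmu hnu hM hMK
  have huniq : ∀ x, fluidDrift lam mu nu M K x = 0 → x = zstar := fun x hx =>
    (strictAnti_fluidDrift hmu hnu).injective (hx.trans hzero.symm)
  have hinv : IsInvariantPoint lam mu nu M K zstar :=
    isInvariantPoint_of_fluidDrift_eq_zero ⟨hpos.le, hle⟩ hzero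
  refine ⟨zstar, fun x => ⟨fun h => huniq x h.fluidDrift_eq_zero, ?_⟩,
    fun x => ⟨fun h => huniq x ((solvesFixedPoint_iff hmu hnu hM h.1).1 h.2), ?_⟩,
    fun n => ?_, ?_, ?_, ?_⟩
  · rintro rfl
    exact hinv
  · rintro rfl
    exact ⟨hpos, (solvesFixedPoint_iff hmu hnu hM hpos).2 hzero⟩
  · obtain ⟨x₀, hx₀⟩ := hreach n
    exact existsUnique_isStationaryLaw (hr n) hx₀
  · intro n Ω _ P _ X π hX hπ s
    obtain ⟨x₀, hx₀⟩ := hreach n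
    exact IsMarkovProcess.tendsto_real (hr n) hx₀ hX hπ s
  · intro Ω _ P _ Y hY hst
    exact ⟨isTightMeasureSet_scaledUncharged hY,
      tendstoInDistribution_stationary hlam hmu hnu hM hinv hY hst⟩
  · intro z0 hz0
    obtain ⟨z, hz, hz0'⟩ := exists_isFluidSolution hlam hmu hnu hM hMK hz0
    refine ⟨z, hz, hz0', fun w hw hw0 => eqOn_of_fluidDrift hmu (convex_Ici 0) Set.self_mem_Ici
      (fun t ht => ht) hw.hasDeriv hz.hasDeriv (hw0.trans hz0'.symm), hz.tendsto hmu hnu hinv, ?_⟩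
    intro Ω _ P _ X Ω' _ P' _ Y hX hZ hQ hY hst
    refine ⟨fun n => ?_, tendstoInDistribution_stationary hlam hmu hnu hM hinv hY hst, fun t => ?_⟩
    · obtain ⟨x₀, hx₀⟩ := hreach n
      refine tendstoInDistribution_comp_of_tendsto_real (hX n).measurable (hY n)
        (scaledUncharged n) fun s => ?_
      rw [← map_real_singleton (hY n)]
      exact IsMarkovProcess.tendsto_real (hr n) hx₀ (hX n) (hst n) s
    · subst hz0'
      exact tendstoInDistribution_fluid hlam hmu hnu hM hz hX hZ hQ t
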